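/- Let $K=\mathbb{R}$ or $K=\mathbb{C}$, let $d\ge 1$ and $n\ge d$ be integers, let $\mathcal{P}_d(K)$ be the set of symmetric (if $K=\mathbb{R}$) or Hermitian (if $K=\mathbb{C}$) positive definite $d\times d$ matrices, and let $\mathcal{S}=\{X\in\mathcal{P}_d(K):\det X=1\}$. Write $\pi:\mathcal{P}_d(K)\to\mathcal{S}$, $\pi(X)=\det(X)^{-1/d}X$, and equip $\mathcal{S}$ with the affine-invariant distance $$d(x,y)=c\,\bigl\|\log\bigl(x^{-1/2}\,y\,x^{-1/2}\bigr)\bigr\|_F ,$$ where $\|\cdot\|_F$ is the Frobenius norm and $c>0$ is an arbitrary fixed constant. For $\Sigma\in\mathcal{P}_d(K)$ let $Y_1,\dots,Y_n$ be independent centred Gaussian vectors in $K^d$ with covariance $\Sigma$ (circularly symmetric complex Gaussian vectors with $\mathbb{E}[YY^*]=\Sigma$ if $K=\mathbb{C}$). The Wishart distribution $\mathcal{W}(\Sigma,n)$ is the law of $\sum_{i=1}^n Y_iY_i^*$, which lies in $\mathcal{P}_d(K)$ almost surely. The projective Wishart distribution $P\mathcal{W}(\Sigma,n)$ is the law on $\mathcal{S}$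 of $\pi(X)$ when $X\sim\mathcal{W}(\Sigma,n)$. Theorem. For every $\Sigma\in\mathcal{P}_d(K)$, the function $x\mapsto\int_{\mathcal{S}}d(x,y)^2\,\mathrm{d}P\mathcal{W}(\Sigma,n)(y)$ is finite on $\mathcal{S}$ and has exactly one minimizer. That is, the Fréchet mean of $P\mathcal{W}(\Sigma,n)$ exists and is unique. It equals the normalized covariance: $$\operatorname*{argmin}_{x\in\mathcal{S}}\int_{\mathcal{S}}d(x,y)^2\,\mathrm{d}P\mathcal{W}(\Sigma,n)(y)=\{\pi(\Sigma)\}=\bigl\{\det(\Sigma)^{-1/d}\,\Sigma\bigr\}.$$ -/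

import Mathlib

open MeasureTheory ProbabilityTheory Matrix Module
open scoped ComplexOrder MatrixOrder ENNReal

noncomputable section

namespace ProjWishart

section Spaces

variable {K : Type*} [RCLike K] {d : ℕ}

/-- The Borel sigma-algebra on square matrices (the product sigma-algebra on the entries). -/
instance instMeasurableSpaceMatrix : MeasurableSpace (Matrix (Fin d) (Fin d) K) :=
  inferInstanceAs (MeasurableSpace (Fin d → Fin d → K))

instance instBorelSpaceMatrix : BorelSpace (Matrix (Fin d) (Fin d) K) :=
  inferInstanceAs (BorelSpace (Fin d → Fin d → K))

variable (K d)

/-- `P_d(K)`: symmetric (`K = ℝ`) or Hermitian (`K = ℂ`) positive definite matrices. -/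
abbrev PosDefMat : Type _ := {X : Matrix (Fin d) (Fin d) K // X.PosDef}

/-- `S`: the positive definite matrices of determinant one. -/
abbrev UnitDet : Type _ := {X : Matrix (Fin d) (Fin d) K // X.PosDef ∧ X.det = 1}

variable {K d}

/-- The real number `det(X)^(-1/d)`; the determinant of a positive definite matrix is a positive
real number. -/
def normFactor (X : Matrix (Fin d) (Fin d) K) : ℝ := (RCLike.re X.det) ^ (-(1 / (d : ℝ)))

lemma normalize_mem {X : Matrix (Fin d) (Fin d) K} (hX : X.PosDef) :
    (normFactor X • X).PosDef ∧ (normFactor X • X).det = 1 := by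
  have hdet := hX.det_pos
  have hre : 0 < RCLike.re X.det := (RCLike.pos_iff.1 hdet).1
  have him : ((RCLike.re X.det : ℝ) : K) = X.det :=
    RCLike.conj_eq_iff_re.1 (RCLike.conj_eq_iff_im.2 (RCLike.pos_iff.1 hdet).2)
  have hpos : 0 < normFactor X := Real.rpow_pos_of_pos hre _
  refine ⟨hX.smul hpos, ?_⟩
  rcases Nat.eq_zero_or_pos d with rfl | hd
  · simp
  · have hd' : (d : ℝ) ≠ 0 := by positivity
    have h1 : normFactor X ^ d * RCLike.re X.det = 1 := by
      rw [normFactor, ← Real.rpow_natCast, ← Real.rpow_mul hre.le]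
      have : -(1 / (d : ℝ)) * d = -1 := by field_simp
      rw [this, Real.rpow_neg_one, inv_mul_cancel₀ hre.ne']
    have h2 : normFactor X • X = ((normFactor X : ℝ) : K) • X := by
      ext i j; simp [RCLike.real_smul_eq_coe_mul]
    rw [h2, Matrix.det_smul, Fintype.card_fin, ← him]
    exact_mod_cast congrArg (fun t : ℝ => (t : K)) h1

/-- The canonical projection `π(X) = det(X)^(-1/d) X` from `P_d(K)` onto `S`. -/
def proj (X : PosDefMat K d) : UnitDet K d := ⟨normFactor X.1 • X.1, normalize_mem X.2⟩

end Spaces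

section Distance

variable {K : Type*} [RCLike K] {d : ℕ}

open scoped Matrix.Norms.Frobenius in
/-- The Frobenius norm of a matrix. -/
def frobeniusNorm (A : Matrix (Fin d) (Fin d) K) : ℝ := ‖A‖

/-- The affine-invariant distance `c * ‖log (x^(-1/2) y x^(-1/2))‖` on `S`, which is defined up to
the choice of a multiplicative constant `c > 0`. -/
def affDist (c : ℝ) (x y : UnitDet K d) : ℝ :=
  c * frobeniusNorm (cfc Real.log ((CFC.sqrt x.1)⁻¹ * y.1 * (CFC.sqrt x.1)⁻¹))

end Distance

section Frechet

variable {α : Type*} [MeasurableSpace α]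

/-- The Fréchet function `x ↦ ∫ dist(x,y)² dμ(y)`, with values in `[0, ∞]`. -/
def frechetFunction (dist : α → α → ℝ) (μ : Measure α) (x : α) : ℝ≥0∞ :=
  ∫⁻ y, ENNReal.ofReal (dist x y ^ 2) ∂μ

/-- The set of Fréchet means of `μ`: all the minimizers of the Fréchet function. -/
def frechetMeans (dist : α → α → ℝ) (μ : Measure α) : Set α :=
  {x | ∀ z, frechetFunction dist μ x ≤ frechetFunction dist μ z}

end Frechet

section Wishart

variable {K : Type*} [RCLike K] {d : ℕ}

/-- The centred Gaussian distribution on `K^d` with covariance `C`, the law of `C^(1/2) Z` where `Z`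
is standard Gaussian, normalized so that `E[Z Z^*] = 1`. For `K = ℝ` this is the usual Gaussian
law. For `K = ℂ` it is the (circularly symmetric) complex Gaussian law: `stdGaussian` on `K^d`, seen
as a real Euclidean space, has independent real and imaginary parts of variance one, whence the
factor `1/√2`. -/
def gaussianLaw (C : Matrix (Fin d) (Fin d) K) : Measure (EuclideanSpace K (Fin d)) :=
  (stdGaussian (EuclideanSpace K (Fin d))).map
    (fun z => (√(finrank ℝ K : ℝ))⁻¹ • toEuclideanCLM (𝕜 := K) (CFC.sqrt C) z)

/-- The Wishart distribution on matrices: the law of `Y₁ Y₁^* + ⋯ + Yₙ Yₙ^*`, with `Y₁, …, Yₙ`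
independent centred Gaussian vectors of covariance `C`. -/
def wishart (C : Matrix (Fin d) (Fin d) K) (n : ℕ) : Measure (Matrix (Fin d) (Fin d) K) :=
  (Measure.pi (fun _ : Fin n => gaussianLaw C)).map
    (fun Y => ∑ i, vecMulVec (fun a => Y i a) (fun b => star (Y i b)))

/-- The projective Wishart distribution on `S`: the law of `π(X)` when `X` is Wishart distributed.
Here the Wishart distribution is seen as a measure on `P_d(K)`, on which it is supported as soon as
`d ≤ n`. -/
def projWishart (C : PosDefMat K d) (n : ℕ) : Measure (UnitDet K d) :=
  ((wishart C.1 n).comap (Subtype.val : PosDefMat K d → Matrix (Fin d) (Fin d) K)).map proj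

end Wishart

end ProjWishart

end

noncomputable section

namespace ProjWishart

/-! ### The Frobenius norm and its unitary invariance -/

section FrobeniusNorm

variable {K : Type*} [RCLike K] {d : ℕ}

/-! Congruence by an invertible matrix, followed by normalization, acts on `UnitDet K d` by
isometries. It carries the law for covariance one to the law for covariance `C` and the point `1` to
`proj C` (`affDist_act_sq`, `projWishart_eq_map`), so it suffices to treat `stdLaw`, with candidate
mean `1`.

Nonpositive curvature enters as one inequality: the matrix logarithm does not increase distances
(`frobeniusNorm_log_sub_log_le_affDist`), with equality when one point is `1` (`affDist_one_left`).
Expanding the square in the flat space of Hermitian matrices gives F(x) ≥ F(1) + c²‖log x‖² − 2c² E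
Re tr(log x log Y), where F is the Fréchet function of `stdLaw` and Y has that law. The cross term
vanishes: the law is invariant under unitary conjugation, so in an eigenbasis of log x all diagonal
entries of log Y have the same mean, while tr log x = log det x = 0
(`integral_re_trace_log_mul_log`). Hence 1 is the strict minimizer.

The argument needs F finite. Since ‖log π(M)‖² is bounded by the trace of M plus a small negative
power of det M, this follows from Gaussian second moments and from a negative moment of the Gram
determinant (`lintegral_det_gram_rpow_ne_top`), which also gives almost sure positive definiteness.
-/

lemma frobeniusNorm_sq (A : Matrix (Fin d) (Fin d) K) :
    frobeniusNorm A ^ 2 = ∑ i, ∑ j, ‖A i j‖ ^ 2 := by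
  rw [frobeniusNorm, Matrix.frobenius_norm_def, ← Real.sqrt_eq_rpow, Real.sq_sqrt]
  · simp
  · positivity

lemma frobeniusNorm_nonneg (A : Matrix (Fin d) (Fin d) K) : 0 ≤ frobeniusNorm A := by
  let : NormedAddCommGroup (Matrix (Fin d) (Fin d) K) := Matrix.frobeniusNormedAddCommGroup
  exact norm_nonneg A

lemma frobeniusNorm_eq_zero {A : Matrix (Fin d) (Fin d) K} (h : frobeniusNorm A = 0) : A = 0 := by
  unfold frobeniusNorm at h
  let : NormedAddCommGroup (Matrix (Fin d) (Fin d) K) := Matrix.frobeniusNormedAddCommGroup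
  exact norm_eq_zero.1 h

lemma frobeniusNorm_sub_le_sum (γ : ℕ → Matrix (Fin d) (Fin d) K) (N : ℕ) :
    frobeniusNorm (γ 0 - γ N) ≤ ∑ k ∈ Finset.range N, frobeniusNorm (γ k - γ (k + 1)) := by
  let : NormedAddCommGroup (Matrix (Fin d) (Fin d) K) := Matrix.frobeniusNormedAddCommGroup
  have h := dist_le_range_sum_dist γ N
  simp only [dist_eq_norm] at h
  exact h

lemma frobeniusNorm_sq_eq_trace (A : Matrix (Fin d) (Fin d) K) :
    frobeniusNorm A ^ 2 = RCLike.re (A * Aᴴ).trace := by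
  rw [frobeniusNorm_sq]
  simp [Matrix.trace, Matrix.mul_apply, RCLike.mul_conj]

lemma frobeniusNorm_mul_unitary (A : Matrix (Fin d) (Fin d) K) {U : Matrix (Fin d) (Fin d) K}
    (hU : U * Uᴴ = 1) : frobeniusNorm (A * U) = frobeniusNorm A := by
  rw [← sq_eq_sq₀ (frobeniusNorm_nonneg _) (frobeniusNorm_nonneg _), frobeniusNorm_sq_eq_trace,
    frobeniusNorm_sq_eq_trace, conjTranspose_mul, Matrix.mul_assoc, ← Matrix.mul_assoc U, hU,
    Matrix.one_mul]

lemma frobeniusNorm_unitary_mul (A : Matrix (Fin d) (Fin d) K) {U : Matrix (Fin d) (Fin d) K}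
    (hU : Uᴴ * U = 1) : frobeniusNorm (U * A) = frobeniusNorm A := by
  rw [← sq_eq_sq₀ (frobeniusNorm_nonneg _) (frobeniusNorm_nonneg _), frobeniusNorm_sq_eq_trace,
    frobeniusNorm_sq_eq_trace, conjTranspose_mul, trace_mul_comm, Matrix.mul_assoc,
    ← Matrix.mul_assoc Uᴴ, hU, Matrix.one_mul, trace_mul_comm]

end FrobeniusNorm

/-! ### Spectral calculus and the local estimate for the logarithm -/

section Spectral

variable {K : Type*} [RCLike K] {d : ℕ}

/-- The diagonal matrix with the given real entries. -/
def realDiag (a : Fin d → ℝ) : Matrix (Fin d) (Fin d) K := diagonal fun i => (a i : K)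

lemma realDiag_mul (a b : Fin d → ℝ) :
    (realDiag a * realDiag b : Matrix (Fin d) (Fin d) K) = realDiag (fun i => a i * b i) := by
  simp [realDiag]

lemma realDiag_one : (realDiag (fun _ => 1) : Matrix (Fin d) (Fin d) K) = 1 := by
  simp [realDiag]

lemma conjTranspose_realDiag (a : Fin d → ℝ) :
    (realDiag a : Matrix (Fin d) (Fin d) K)ᴴ = realDiag a := by
  simp [realDiag, diagonal_conjTranspose, Pi.star_def]

lemma trace_realDiag (a : Fin d → ℝ) :
    (realDiag a : Matrix (Fin d) (Fin d) K).trace = ((∑ i, a i : ℝ) : K) := by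
  simp [realDiag, trace]

/-- One eigenbasis serves every function `f` at once, which reduces the functional calculus to real
diagonal matrices. -/
lemma exists_spectral {X : Matrix (Fin d) (Fin d) K} (hX : X.PosDef) :
    ∃ (U : Matrix (Fin d) (Fin d) K) (a : Fin d → ℝ), Uᴴ * U = 1 ∧ U * Uᴴ = 1 ∧ (∀ i, 0 < a i) ∧
      X = U * realDiag a * Uᴴ ∧ ∀ f : ℝ → ℝ, cfc f X = U * realDiag (fun i => f (a i)) * Uᴴ := by
  have key : ∀ f : ℝ → ℝ, cfc f X = (hX.1.eigenvectorUnitary : Matrix (Fin d) (Fin d) K) *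
      realDiag (fun i => f (hX.1.eigenvalues i)) *
      (hX.1.eigenvectorUnitary : Matrix (Fin d) (Fin d) K)ᴴ := by
    intro f
    rw [hX.1.cfc_eq, IsHermitian.cfc, Unitary.conjStarAlgAut_apply]
    rfl
  refine ⟨hX.1.eigenvectorUnitary, hX.1.eigenvalues, ?_, ?_, hX.eigenvalues_pos, ?_, key⟩
  · exact (Unitary.mem_iff.1 hX.1.eigenvectorUnitary.2).1
  · exact (Unitary.mem_iff.1 hX.1.eigenvectorUnitary.2).2
  · exact (cfc_id' ℝ X hX.1).symm.trans (key fun x => x)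

lemma frobeniusNorm_conj_realDiag_sq {U : Matrix (Fin d) (Fin d) K} (h1 : Uᴴ * U = 1)
    (a : Fin d → ℝ) :
    frobeniusNorm (U * realDiag a * Uᴴ) ^ 2 = ∑ i, a i ^ 2 := by
  rw [frobeniusNorm_mul_unitary _ (by simpa using h1), frobeniusNorm_unitary_mul _ h1,
    frobeniusNorm_sq_eq_trace, conjTranspose_realDiag, realDiag_mul, trace_realDiag]
  simp [sq]

lemma inv_conj_realDiag {U : Matrix (Fin d) (Fin d) K} (h1 : Uᴴ * U = 1)
    (h2 : U * Uᴴ = 1) {a : Fin d → ℝ} (ha : ∀ i, 0 < a i) :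
    (U * realDiag a * Uᴴ)⁻¹ = U * realDiag (fun i => (a i)⁻¹) * Uᴴ := by
  refine Matrix.inv_eq_right_inv ?_
  calc U * realDiag a * Uᴴ * (U * realDiag (fun i => (a i)⁻¹) * Uᴴ)
      = U * realDiag a * (Uᴴ * U) * realDiag (fun i => (a i)⁻¹) * Uᴴ := by
        simp only [Matrix.mul_assoc]
    _ = 1 := by
        rw [h1, Matrix.mul_one, Matrix.mul_assoc U, realDiag_mul]
        simp [(ha _).ne', realDiag_one, h2]

/-- For unitary `U` and `V`, the weights ‖(UᴴV)ᵢⱼ‖² are the overlaps of the two eigenbases. They do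
not depend on the eigenvalues, so trace inequalities reduce to scalar inequalities for each pair (i,
j). -/
lemma re_trace_conj_mul_conj {U V : Matrix (Fin d) (Fin d) K} (a b : Fin d → ℝ) :
    RCLike.re ((U * realDiag a * Uᴴ) * (V * realDiag b * Vᴴ)).trace
      = ∑ i, ∑ j, ‖(Uᴴ * V) i j‖ ^ 2 * (a i * b j) := by
  have h : ((U * realDiag a * Uᴴ) * (V * realDiag b * Vᴴ)).trace
      = ((realDiag a * (Uᴴ * V)) * (realDiag b * (Uᴴ * V)ᴴ)).trace := by
    rw [conjTranspose_mul, conjTranspose_conjTranspose]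
    rw [show (U * realDiag a * Uᴴ) * (V * realDiag b * Vᴴ)
      = U * (realDiag a * Uᴴ * (V * realDiag b * Vᴴ)) by simp only [Matrix.mul_assoc],
      trace_mul_comm]
    simp only [Matrix.mul_assoc]
  rw [h]
  simp only [trace, diag_apply, map_sum]
  refine Finset.sum_congr rfl fun i _ => ?_
  rw [Matrix.mul_apply, map_sum]
  simp only [realDiag, diagonal_mul, conjTranspose_apply, RCLike.star_def]
  refine Finset.sum_congr rfl fun j _ => ?_
  have : (a i : K) * (Uᴴ * V) i j * ((b j : K) * (starRingEnd K) ((Uᴴ * V) i j))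
      = ((‖(Uᴴ * V) i j‖ ^ 2 * (a i * b j) : ℝ) : K) := by
    have := RCLike.mul_conj ((Uᴴ * V) i j)
    push_cast
    rw [← this]; ring
  rw [this, RCLike.ofReal_re]

lemma frobeniusNorm_conj_sub_conj_sq {U V : Matrix (Fin d) (Fin d) K} (hU : Uᴴ * U = 1)
    (hU' : U * Uᴴ = 1) (hV : Vᴴ * V = 1) (hV' : V * Vᴴ = 1) (a b : Fin d → ℝ) :
    frobeniusNorm (U * realDiag a * Uᴴ - V * realDiag b * Vᴴ) ^ 2
      = ∑ i, ∑ j, ‖(Uᴴ * V) i j‖ ^ 2 * (a i - b j) ^ 2 := by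
  rw [← frobeniusNorm_mul_unitary _ hV',
    ← frobeniusNorm_unitary_mul (U := Uᴴ) _ (by simpa using hU')]
  have : Uᴴ * ((U * realDiag a * Uᴴ - V * realDiag b * Vᴴ) * V)
      = realDiag a * (Uᴴ * V) - (Uᴴ * V) * realDiag b := by
    rw [Matrix.sub_mul, Matrix.mul_sub]
    congr 1
    · rw [← Matrix.mul_assoc, ← Matrix.mul_assoc, ← Matrix.mul_assoc, hU, Matrix.one_mul,
        Matrix.mul_assoc]
    · rw [Matrix.mul_assoc _ Vᴴ, hV, Matrix.mul_one, Matrix.mul_assoc]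
  rw [this, frobeniusNorm_sq]
  refine Finset.sum_congr rfl fun i _ => Finset.sum_congr rfl fun j _ => ?_
  have : (realDiag a * (Uᴴ * V) - (Uᴴ * V) * realDiag b : Matrix (Fin d) (Fin d) K) i j
      = (Uᴴ * V) i j * ((a i - b j : ℝ) : K) := by
    simp only [realDiag, Matrix.sub_apply, diagonal_mul, mul_diagonal]
    push_cast; ring
  rw [this, norm_mul, mul_pow, RCLike.norm_ofReal, sq_abs]

/-- `t ^ 2 ≤ e^t + e^{-t} - 2`, in multiplicative form. -/
lemma sq_log_sub_log_le {a b : ℝ} (ha : 0 < a) (hb : 0 < b) :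
    (Real.log a - Real.log b) ^ 2 ≤ a⁻¹ * b + a * b⁻¹ - 2 := by
  -- With half the log-ratio, the right-hand side is the perfect square (2 sinh t)², and |t| ≤ sinh
  -- |t| finishes.
  set t := (Real.log b - Real.log a) / 2 with ht
  have h1 : a⁻¹ * b = Real.exp t ^ 2 := by
    rw [← Real.exp_nat_mul, ht]
    push_cast
    rw [mul_div_cancel₀ _ two_ne_zero, Real.exp_sub, Real.exp_log ha, Real.exp_log hb]
    field_simp
  have h2 : a * b⁻¹ = Real.exp (-t) ^ 2 := by
    rw [← Real.exp_nat_mul, ht]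
    push_cast
    rw [show 2 * -((Real.log b - Real.log a) / 2) = Real.log a - Real.log b by ring,
      Real.exp_sub, Real.exp_log ha, Real.exp_log hb]
    field_simp
  have h3 : Real.exp t * Real.exp (-t) = 1 := by rw [← Real.exp_add]; simp
  have h4 : (Real.exp t - Real.exp (-t)) ^ 2 = (2 * Real.sinh t) ^ 2 := by
    rw [Real.sinh_eq]; ring
  have h5 : t ^ 2 ≤ Real.sinh t ^ 2 := by
    rw [sq_le_sq, Real.abs_sinh]
    exact Real.self_le_sinh_iff.2 (abs_nonneg t)
  calc (Real.log a - Real.log b) ^ 2 = 4 * t ^ 2 := by rw [ht]; ring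
    _ ≤ (2 * Real.sinh t) ^ 2 := by nlinarith
    _ = _ := by rw [← h4, h1, h2]; linear_combination (-2 : ℝ) * h3

/-- All terms are sums over pairs of eigenvalues with the same nonnegative overlap weights, so
`sq_log_sub_log_le` applies pair by pair. The right-hand side agrees to second order with the
squared affine-invariant distance, which makes the bound sharp for nearby points. -/
lemma frobeniusNorm_log_sub_log_sq_le {X Y : Matrix (Fin d) (Fin d) K} (hX : X.PosDef)
    (hY : Y.PosDef) :
    frobeniusNorm (cfc Real.log X - cfc Real.log Y) ^ 2
      ≤ RCLike.re (X⁻¹ * Y).trace + RCLike.re (X * Y⁻¹).trace - 2 * d := by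
  obtain ⟨U, a, hU, hU', ha, hXU, hfX⟩ := exists_spectral hX
  obtain ⟨V, b, hV, hV', hb, hYV, hfY⟩ := exists_spectral hY
  have h1 : RCLike.re (X⁻¹ * Y).trace = ∑ i, ∑ j, ‖(Uᴴ * V) i j‖ ^ 2 * ((a i)⁻¹ * b j) := by
    rw [← re_trace_conj_mul_conj, ← inv_conj_realDiag hU hU' ha, ← hXU, ← hYV]
  have h2 : RCLike.re (X * Y⁻¹).trace = ∑ i, ∑ j, ‖(Uᴴ * V) i j‖ ^ 2 * (a i * (b j)⁻¹) := by
    rw [← re_trace_conj_mul_conj, ← inv_conj_realDiag hV hV' hb, ← hXU, ← hYV]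
  -- The overlap weights have total mass `d`: this is the trace of 1 · 1 written in the two
  -- eigenbases.
  have h3 : (d : ℝ) = ∑ i, ∑ j, ‖(Uᴴ * V) i j‖ ^ 2 * ((1 : ℝ) * 1) := by
    rw [← re_trace_conj_mul_conj (fun _ => 1) (fun _ => 1), realDiag_one, Matrix.mul_one,
      Matrix.mul_one, hU', hV', Matrix.mul_one, trace_one]
    simp
  rw [hfX, hfY, frobeniusNorm_conj_sub_conj_sq hU hU' hV hV', h1, h2, h3, Finset.mul_sum,
    ← Finset.sum_add_distrib, ← Finset.sum_sub_distrib]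
  refine Finset.sum_le_sum fun i _ => ?_
  rw [Finset.mul_sum, ← Finset.sum_add_distrib, ← Finset.sum_sub_distrib]
  refine Finset.sum_le_sum fun j _ => ?_
  have := mul_le_mul_of_nonneg_left (sq_log_sub_log_le (ha i) (hb j))
    (sq_nonneg ‖(Uᴴ * V) i j‖)
  linarith

end Spectral

/-! ### From the local estimate to a global one along geodesics -/

section LogarithmicComparison

variable {K : Type*} [RCLike K] {d : ℕ}

lemma posDef_realDiag {a : Fin d → ℝ} (ha : ∀ i, 0 < a i) :
    (realDiag a : Matrix (Fin d) (Fin d) K).PosDef :=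
  posDef_diagonal_iff.2 fun i => by exact_mod_cast ha i

lemma _root_.Matrix.PosDef.mul_mul_conjTranspose_of_isUnit {X G : Matrix (Fin d) (Fin d) K}
    (hX : X.PosDef) (hG : IsUnit G) : (G * X * Gᴴ).PosDef :=
  (IsUnit.posDef_star_right_conjugate_iff hG).2 hX

lemma re_trace_inv_mul_conj_realDiag {G : Matrix (Fin d) (Fin d) K} (hG : IsUnit G)
    {p : Fin d → ℝ} (hp : ∀ i, 0 < p i) (q : Fin d → ℝ) :
    RCLike.re ((G * realDiag p * Gᴴ)⁻¹ * (G * realDiag q * Gᴴ)).trace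
      = ∑ i, (p i)⁻¹ * q i := by
  have hGd : IsUnit G.det := (isUnit_iff_isUnit_det _).1 hG
  have hGd' : IsUnit Gᴴ.det := by rw [det_conjTranspose]; exact hGd.star
  have hinv : (G * realDiag p * Gᴴ)⁻¹ = (Gᴴ)⁻¹ * realDiag (fun i => (p i)⁻¹) * G⁻¹ := by
    refine Matrix.inv_eq_right_inv ?_
    calc G * realDiag p * Gᴴ * ((Gᴴ)⁻¹ * realDiag (fun i => (p i)⁻¹) * G⁻¹)
        = G * realDiag p * (Gᴴ * (Gᴴ)⁻¹) * realDiag (fun i => (p i)⁻¹) * G⁻¹ := by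
          simp only [Matrix.mul_assoc]
      _ = 1 := by
          rw [mul_nonsing_inv _ hGd', Matrix.mul_one, Matrix.mul_assoc G, realDiag_mul]
          simp [(hp _).ne', realDiag_one, mul_nonsing_inv _ hGd]
  have : (G * realDiag p * Gᴴ)⁻¹ * (G * realDiag q * Gᴴ)
      = (Gᴴ)⁻¹ * (realDiag (fun i => (p i)⁻¹ * q i) * Gᴴ) := by
    rw [hinv, ← realDiag_mul]
    calc _ = (Gᴴ)⁻¹ * realDiag (fun i => (p i)⁻¹) * (G⁻¹ * G) * realDiag q * Gᴴ := by
          simp only [Matrix.mul_assoc]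
      _ = _ := by rw [nonsing_inv_mul _ hGd, Matrix.mul_one]; simp only [Matrix.mul_assoc]
  rw [this, trace_mul_comm, Matrix.mul_assoc, mul_nonsing_inv _ hGd', Matrix.mul_one,
    trace_realDiag, RCLike.ofReal_re]

/-- The traces in the local estimate are unchanged by a common congruence, so `G` disappears from
the bound although it does not commute with the logarithm. -/
lemma frobeniusNorm_log_conj_sub_log_conj_sq_le {G : Matrix (Fin d) (Fin d) K} (hG : IsUnit G)
    {p q : Fin d → ℝ} (hp : ∀ i, 0 < p i) (hq : ∀ i, 0 < q i) :
    frobeniusNorm (cfc Real.log (G * realDiag p * Gᴴ) - cfc Real.log (G * realDiag q * Gᴴ)) ^ 2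
      ≤ ∑ i, ((p i)⁻¹ * q i + (q i)⁻¹ * p i - 2) := by
  have hX := (posDef_realDiag (K := K) hp).mul_mul_conjTranspose_of_isUnit hG
  have hY := (posDef_realDiag (K := K) hq).mul_mul_conjTranspose_of_isUnit hG
  refine (frobeniusNorm_log_sub_log_sq_le hX hY).trans (le_of_eq ?_)
  rw [trace_mul_comm (G * realDiag p * Gᴴ), re_trace_inv_mul_conj_realDiag hG hp,
    re_trace_inv_mul_conj_realDiag hG hq]
  simp [Finset.sum_add_distrib, mul_comm]

/-- The expression is the square of 2N sinh(t/(2N)), a difference quotient at 0 of s ↦ 2 sinh(st/2).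
-/
lemma tendsto_sq_mul_exp_add_exp_neg (t : ℝ) :
    Filter.Tendsto (fun N : ℕ => (N : ℝ) ^ 2 * (Real.exp (t / N) + Real.exp (-(t / N)) - 2))
      Filter.atTop (nhds (t ^ 2)) := by
  have h1 : HasDerivAt (fun s : ℝ => 2 * Real.sinh (s * (t / 2))) t 0 := by
    have := ((Real.hasDerivAt_sinh ((0 : ℝ) * (t / 2))).comp (0 : ℝ)
      ((hasDerivAt_id (0 : ℝ)).mul_const (t / 2))).const_mul 2
    simp only [zero_mul, Real.cosh_zero, one_mul] at this
    rw [mul_div_cancel₀ _ two_ne_zero] at this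
    exact this
  have h2 := (h1.tendsto_slope_zero_right.comp
    (tendsto_inv_atTop_nhdsGT_zero.comp tendsto_natCast_atTop_atTop)).pow 2
  refine h2.congr fun N => ?_
  simp only [Function.comp_apply, zero_add, inv_inv, zero_mul, Real.sinh_zero, mul_zero, sub_zero,
    smul_eq_mul, mul_pow]
  congr 1
  rw [Real.sinh_eq]
  have e1 : Real.exp (t / N) = Real.exp ((N : ℝ)⁻¹ * (t / 2)) ^ 2 := by
    rw [← Real.exp_nat_mul]; congr 1; push_cast; ring
  have e2 : Real.exp (-(t / N)) = Real.exp (-((N : ℝ)⁻¹ * (t / 2))) ^ 2 := by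
    rw [← Real.exp_nat_mul]; congr 1; push_cast; ring
  have e3 : Real.exp ((N : ℝ)⁻¹ * (t / 2)) * Real.exp (-((N : ℝ)⁻¹ * (t / 2))) = 1 := by
    rw [← Real.exp_add]; simp
  rw [e1, e2]
  linear_combination (-2 : ℝ) * e3

/-- The matrix logarithm does not increase distances from `P_d(K)`, with the affine-invariant
distance, to the Hermitian matrices, with the Frobenius distance. -/
lemma frobeniusNorm_log_sub_log_conj_exp_sq_le {G : Matrix (Fin d) (Fin d) K} (hG : IsUnit G)
    (t : Fin d → ℝ) :
    frobeniusNorm (cfc Real.log (G * Gᴴ)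
      - cfc Real.log (G * realDiag (fun i => Real.exp (t i)) * Gᴴ)) ^ 2 ≤ ∑ i, t i ^ 2 := by
  -- The geodesic s ↦ G exp(st) Gᴴ is cut into N equal steps. Each step has the same local bound R,
  -- the triangle inequality gives N²R in total, and N²R tends to ∑ tᵢ².
  refine ge_of_tendsto (tendsto_finsetSum Finset.univ
    fun i _ => tendsto_sq_mul_exp_add_exp_neg (t i)) ?_
  filter_upwards [Filter.eventually_gt_atTop 0] with N hN
  have hN' : (N : ℝ) ≠ 0 := by exact_mod_cast hN.ne'
  set γ : ℕ → Matrix (Fin d) (Fin d) K := fun k =>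
    cfc Real.log (G * realDiag (fun i => Real.exp (k * (t i / N))) * Gᴴ) with hγ
  set R : ℝ := ∑ i, (Real.exp (t i / N) + Real.exp (-(t i / N)) - 2) with hR
  have hstep : ∀ k, frobeniusNorm (γ k - γ (k + 1)) ^ 2 ≤ R := by
    intro k
    refine (frobeniusNorm_log_conj_sub_log_conj_sq_le hG (fun i => Real.exp_pos _)
      (fun i => Real.exp_pos _)).trans (le_of_eq ?_)
    refine Finset.sum_congr rfl fun i _ => ?_
    rw [← Real.exp_neg, ← Real.exp_neg, ← Real.exp_add, ← Real.exp_add]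
    congr 3 <;> · push_cast; ring
  have h0 : γ 0 = cfc Real.log (G * Gᴴ) := by simp [hγ, realDiag_one]
  have h1 : γ N = cfc Real.log (G * realDiag (fun i => Real.exp (t i)) * Gᴴ) := by
    simp only [hγ]
    congr 5 with i
    rw [mul_div_cancel₀ _ hN']
  have hsum : frobeniusNorm (γ 0 - γ N) ≤ N * √R := by
    refine (frobeniusNorm_sub_le_sum γ N).trans ?_
    refine (Finset.sum_le_card_nsmul _ _ (√R) fun k _ => Real.le_sqrt_of_sq_le (hstep k)).trans ?_
    simp
  have hR0 : 0 ≤ R := (sq_nonneg _).trans (hstep 0)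
  calc _ = frobeniusNorm (γ 0 - γ N) ^ 2 := by rw [h0, h1]
    _ ≤ (N * √R) ^ 2 := pow_le_pow_left₀ (frobeniusNorm_nonneg _) hsum 2
    _ = _ := by rw [mul_pow, Real.sq_sqrt hR0, hR, Finset.mul_sum]

end LogarithmicComparison

/-! ### The affine-invariant distance -/

section Distance

variable {K : Type*} [RCLike K] {d : ℕ}

lemma sqrt_spec {X : Matrix (Fin d) (Fin d) K} (hX : X.PosDef) :
    (CFC.sqrt X)ᴴ = CFC.sqrt X ∧ CFC.sqrt X * CFC.sqrt X = X ∧ IsUnit (CFC.sqrt X) := by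
  have h1 : CFC.sqrt X * CFC.sqrt X = X := CFC.sqrt_mul_sqrt_self X hX.posSemidef.nonneg
  refine ⟨(CFC.sqrt_nonneg X).isSelfAdjoint, h1, ?_⟩
  have := hX.isUnit
  rw [← h1] at this
  rw [isUnit_iff_isUnit_det] at this ⊢
  rw [det_mul] at this
  exact isUnit_of_mul_isUnit_left this

lemma posDef_whiten {X Y : Matrix (Fin d) (Fin d) K} (hX : X.PosDef) (hY : Y.PosDef) :
    ((CFC.sqrt X)⁻¹ * Y * (CFC.sqrt X)⁻¹).PosDef := by
  obtain ⟨h1, -, h3⟩ := sqrt_spec hX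
  have := hY.mul_mul_conjTranspose_of_isUnit (G := (CFC.sqrt X)⁻¹) (by
    rw [isUnit_iff_isUnit_det] at h3 ⊢
    exact isUnit_nonsing_inv_det _ h3)
  rwa [conjTranspose_nonsing_inv, h1] at this

/-- A single congruence brings both points to diagonal form: with S = x^(1/2) and V diagonalizing
the whitened `y`, one has x = (SV)(SV)ᴴ and y = (SV) exp(t) (SV)ᴴ, where c²∑ tᵢ² is the squared
distance. -/
lemma frobeniusNorm_log_sub_log_le_affDist {c : ℝ} (hc : 0 ≤ c) (x y : UnitDet K d) :
    c * frobeniusNorm (cfc Real.log x.1 - cfc Real.log y.1) ≤ affDist c x y := by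
  refine mul_le_mul_of_nonneg_left ?_ hc
  obtain ⟨h1, h2, h3⟩ := sqrt_spec x.2.1
  have h3' : IsUnit (CFC.sqrt x.1).det := (isUnit_iff_isUnit_det _).1 h3
  set S := CFC.sqrt x.1
  obtain ⟨V, z, hV, hV', hz, hZ, hf⟩ := exists_spectral (posDef_whiten x.2.1 y.2.1)
  rw [← sq_le_sq₀ (frobeniusNorm_nonneg _) (frobeniusNorm_nonneg _), hf,
    frobeniusNorm_conj_realDiag_sq hV]
  have hSV : IsUnit (S * V) := h3.mul (IsUnit.of_mul_eq_one Vᴴ hV')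
  have key := frobeniusNorm_log_sub_log_conj_exp_sq_le hSV (fun i => Real.log (z i))
  have e1 : S * V * (S * V)ᴴ = x.1 := by
    rw [conjTranspose_mul, h1, Matrix.mul_assoc, ← Matrix.mul_assoc V, hV', Matrix.one_mul, h2]
  have e2 : S * V * realDiag (fun i => Real.exp (Real.log (z i))) * (S * V)ᴴ = y.1 := by
    simp only [Real.exp_log (hz _)]
    rw [conjTranspose_mul, h1, show S * V * realDiag z * (Vᴴ * S) = S * (V * realDiag z * Vᴴ) * S by
      simp only [Matrix.mul_assoc], ← hZ, Matrix.mul_assoc, Matrix.mul_assoc,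
      nonsing_inv_mul _ h3', Matrix.mul_one, ← Matrix.mul_assoc, mul_nonsing_inv _ h3',
      Matrix.one_mul]
  rwa [e1, e2] at key

/-- The sum of the squared logarithms of the roots of a polynomial. -/
def logSqRoots (p : Polynomial K) : ℝ :=
  (p.roots.map fun z => Real.log (RCLike.re z) ^ 2).sum

lemma frobeniusNorm_log_sq {Z : Matrix (Fin d) (Fin d) K} (hZ : Z.PosDef) :
    frobeniusNorm (cfc Real.log Z) ^ 2 = logSqRoots Z.charpoly := by
  obtain ⟨V, z, hV, hV', hz, hZV, hf⟩ := exists_spectral hZ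
  have : Z.charpoly = ∏ i, (Polynomial.X - Polynomial.C (z i : K)) := by
    rw [hZV, Matrix.mul_assoc, charpoly_mul_comm, Matrix.mul_assoc, hV, Matrix.mul_one, realDiag,
      charpoly_diagonal]
  rw [hf, frobeniusNorm_conj_realDiag_sq hV, logSqRoots, this, Polynomial.roots_prod]
  · simp [List.sum_ofFn]
  · exact Finset.prod_ne_zero_iff.2 fun i _ => Polynomial.X_sub_C_ne_zero _

/-- The whitened matrix has the same characteristic polynomial as x⁻¹y. This form is free of square
roots, which makes the invariance under congruence visible. -/
lemma affDist_sq (c : ℝ) (x y : UnitDet K d) :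
    affDist c x y ^ 2 = c ^ 2 * logSqRoots (x.1⁻¹ * y.1).charpoly := by
  obtain ⟨h1, h2, h3⟩ := sqrt_spec x.2.1
  rw [affDist, mul_pow, frobeniusNorm_log_sq (posDef_whiten x.2.1 y.2.1), charpoly_mul_comm,
    ← Matrix.mul_assoc, ← Matrix.mul_inv_rev, h2]

instance : One (UnitDet K d) := ⟨⟨1, PosDef.one, det_one⟩⟩

lemma coe_one_unitDet : (1 : UnitDet K d).1 = 1 := rfl

lemma affDist_one_left (c : ℝ) (y : UnitDet K d) :
    affDist c 1 y = c * frobeniusNorm (cfc Real.log y.1) := by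
  have : CFC.sqrt (1 : Matrix (Fin d) (Fin d) K) = 1 := CFC.sqrt_one
  rw [affDist, coe_one_unitDet, this]
  simp

end Distance

/-! ### The isometric action of the general linear group -/

section Action

variable {K : Type*} [RCLike K] {d : ℕ}

lemma det_real_smul (r : ℝ) (Z : Matrix (Fin d) (Fin d) K) :
    (r • Z).det = ((r ^ d : ℝ) : K) * Z.det := by
  have h2 : r • Z = (r : K) • Z := by
    ext i j; simp [RCLike.real_smul_eq_coe_mul]
  rw [h2, det_smul, Fintype.card_fin]
  push_cast; rfl

/-- A ray meets `UnitDet K d` in at most one point. Thanks to this, normalizing factors never have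
to be computed. -/
lemma unitDet_eq_of_smul {x y : UnitDet K d} {r s : ℝ} (hr : 0 < r) (hs : 0 < s)
    {Z : Matrix (Fin d) (Fin d) K} (hx : x.1 = r • Z) (hy : y.1 = s • Z) : x = y := by
  refine Subtype.ext ?_
  rcases Nat.eq_zero_or_pos d with rfl | hd
  · exact Subsingleton.elim _ _
  have h1 := x.2.2
  have h2 := y.2.2
  rw [hx, det_real_smul] at h1
  rw [hy, det_real_smul] at h2
  have hZ : Z.det ≠ 0 := fun h => by simp [h] at h1
  have h3 : r ^ d = s ^ d := by
    have := mul_right_cancel₀ hZ (h1.trans h2.symm)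
    exact_mod_cast this
  rw [hx, hy, (pow_left_inj₀ hr.le hs.le hd.ne').1 h3]

lemma normFactor_pos {X : Matrix (Fin d) (Fin d) K} (hX : X.PosDef) : 0 < normFactor X :=
  Real.rpow_pos_of_pos (RCLike.pos_iff.1 hX.det_pos).1 _

/-- The action of invertible matrices on `S` by congruence, up to normalization. -/
def act (g : GL (Fin d) K) (y : UnitDet K d) : UnitDet K d :=
  proj ⟨g.1 * y.1 * (g.1)ᴴ, y.2.1.mul_mul_conjTranspose_of_isUnit g.isUnit⟩

lemma exists_coe_act (g : GL (Fin d) K) (y : UnitDet K d) :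
    ∃ r : ℝ, 0 < r ∧ (act g y).1 = r • (g.1 * y.1 * (g.1)ᴴ) :=
  ⟨_, normFactor_pos (y.2.1.mul_mul_conjTranspose_of_isUnit g.isUnit), rfl⟩

lemma act_mul (g h : GL (Fin d) K) (y : UnitDet K d) : act (g * h) y = act g (act h y) := by
  obtain ⟨r, hr, e⟩ := exists_coe_act (g * h) y
  obtain ⟨s, hs, e'⟩ := exists_coe_act h y
  obtain ⟨u, hu, e''⟩ := exists_coe_act g (act h y)
  refine unitDet_eq_of_smul (Z := g.1 * h.1 * y.1 * (g.1 * h.1)ᴴ) hr (mul_pos hu hs) e ?_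
  rw [e'', e', conjTranspose_mul, mul_smul]
  simp only [Matrix.mul_smul, Matrix.smul_mul, Matrix.mul_assoc]

lemma act_one (y : UnitDet K d) : act 1 y = y := by
  obtain ⟨r, hr, e⟩ := exists_coe_act 1 y
  refine unitDet_eq_of_smul hr one_pos e ?_
  simp

/-- Both points have determinant one, so they are rescaled by the same factor, which cancels in
x⁻¹y. What remains is a conjugate of x⁻¹y, with the same characteristic polynomial. -/
lemma affDist_act_sq (c : ℝ) (g : GL (Fin d) K) (x y : UnitDet K d) :
    affDist c (act g x) (act g y) ^ 2 = affDist c x y ^ 2 := by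
  obtain ⟨r, hr, e⟩ := exists_coe_act g x
  obtain ⟨s, hs, e'⟩ := exists_coe_act g y
  rcases Nat.eq_zero_or_pos d with rfl | hd
  · rw [Subsingleton.elim (act g x) x, Subsingleton.elim (act g y) y]
  have hrs : r = s := by
    have h1 := (act g x).2.2
    have h2 := (act g y).2.2
    rw [e, det_real_smul, det_mul, det_mul, x.2.2] at h1
    rw [e', det_real_smul, det_mul, det_mul, y.2.2] at h2
    have hZ : g.1.det * 1 * (g.1)ᴴ.det ≠ 0 := fun h => by rw [h] at h1; simp at h1
    have h3 : r ^ d = s ^ d := by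
      have := mul_right_cancel₀ hZ (h1.trans h2.symm)
      exact_mod_cast this
    exact (pow_left_inj₀ hr.le hs.le hd.ne').1 h3
  have hg : IsUnit g.1.det := (isUnit_iff_isUnit_det _).1 g.isUnit
  have hg' : IsUnit (g.1)ᴴ.det := by rw [det_conjTranspose]; exact hg.star
  rw [affDist_sq, affDist_sq, e, e', ← hrs]
  have : (r • (g.1 * x.1 * (g.1)ᴴ))⁻¹ * (r • (g.1 * y.1 * (g.1)ᴴ))
      = ((g.1)ᴴ)⁻¹ * (x.1⁻¹ * y.1 * (g.1)ᴴ) := by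
    have hi : (r • (g.1 * x.1 * (g.1)ᴴ))⁻¹ = r⁻¹ • (g.1 * x.1 * (g.1)ᴴ)⁻¹ := by
      refine Matrix.inv_eq_right_inv ?_
      rw [Matrix.smul_mul, Matrix.mul_smul, smul_smul, mul_inv_cancel₀ hr.ne', one_smul]
      refine mul_nonsing_inv _ ((isUnit_iff_isUnit_det _).1
        (x.2.1.mul_mul_conjTranspose_of_isUnit g.isUnit).isUnit)
    rw [hi, Matrix.smul_mul, Matrix.mul_smul, smul_smul, inv_mul_cancel₀ hr.ne', one_smul,
      Matrix.mul_inv_rev, Matrix.mul_inv_rev]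
    calc _ = ((g.1)ᴴ)⁻¹ * (x.1⁻¹ * (g.1⁻¹ * g.1) * y.1 * (g.1)ᴴ) := by simp only [Matrix.mul_assoc]
      _ = _ := by rw [nonsing_inv_mul _ hg, Matrix.mul_one]
  rw [this, charpoly_mul_comm, Matrix.mul_assoc, mul_nonsing_inv _ hg', Matrix.mul_one]

end Action

/-! ### Negative moments of Gaussian determinants -/

section NegativeMoments

/-- The moment of order `-1/2` of a standard Gaussian variable. -/
def gaussianNegMoment : ℝ≥0∞ := ∫⁻ t, ‖t‖ₑ ^ (-(1 / 2) : ℝ) ∂gaussianReal 0 1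

lemma lintegral_Ioo_enorm_rpow_ne_top :
    ∫⁻ t in Set.Ioo (-1 : ℝ) 1, ‖t‖ₑ ^ (-(1 / 2) : ℝ) ≠ ∞ := by
  have h0 : IntervalIntegrable (fun t : ℝ => |t| ^ (-(1 / 2) : ℝ)) volume 0 1 := by
    refine (intervalIntegral.intervalIntegrable_rpow' (r := (-(1 / 2) : ℝ))
      (by norm_num)).congr fun t ht => ?_
    rw [Set.uIoc_of_le zero_le_one] at ht
    simp only [abs_of_pos ht.1]
  have h1 : IntervalIntegrable (fun t : ℝ => |t| ^ (-(1 / 2) : ℝ)) volume (-1) 0 := by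
    have := (IntervalIntegrable.iff_comp_neg).1 h0
    simpa using this.symm
  have h2 := (h1.trans h0).1.mono_set (Set.Ioo_subset_Ioc_self)
  have h3 := h2.2
  rw [HasFiniteIntegral] at h3
  refine ne_of_lt (lt_of_le_of_lt (le_of_eq ?_) h3)
  refine setLIntegral_congr_fun_ae measurableSet_Ioo ?_
  -- The origin must be discarded: there the negative power is `0` in `ℝ` but `∞` in `ℝ≥0∞`.
  filter_upwards [compl_mem_ae_iff.2 (Real.volume_singleton (a := 0))] with t ht _
  have ht' : 0 < |t| := abs_pos.2 ht
  rw [Real.enorm_eq_ofReal_abs t, Real.enorm_eq_ofReal (by positivity),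
    ENNReal.ofReal_rpow_of_pos ht']

lemma gaussianNegMoment_ne_top : gaussianNegMoment ≠ ∞ := by
  have hpdf : ∀ t, gaussianPDF 0 1 t ≤ 1 := by
    intro t
    rw [gaussianPDF, ← ENNReal.ofReal_one]
    refine ENNReal.ofReal_le_ofReal ?_
    rw [gaussianPDFReal]
    have h1 : (√(2 * Real.pi * (1 : NNReal)))⁻¹ ≤ 1 := by
      refine inv_le_one_of_one_le₀ (Real.one_le_sqrt.2 ?_)
      have := Real.pi_gt_three
      push_cast; linarith
    have h2 : Real.exp (-(t - 0) ^ 2 / (2 * (1 : NNReal))) ≤ 1 := by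
      rw [Real.exp_le_one_iff]
      have := sq_nonneg t
      push_cast; simp only [sub_zero]; linarith
    exact mul_le_one₀ h1 (Real.exp_pos _).le h2
  have hle : gaussianReal 0 1 ≤ volume := by
    rw [gaussianReal_of_var_ne_zero _ one_ne_zero]
    calc volume.withDensity (gaussianPDF 0 1) ≤ volume.withDensity 1 :=
          withDensity_mono (Filter.Eventually.of_forall hpdf)
      _ = volume := withDensity_one
  rw [gaussianNegMoment, ← lintegral_add_compl _ (measurableSet_Ioo (a := (-1 : ℝ)) (b := 1))]
  refine ENNReal.add_ne_top.2 ⟨?_, ?_⟩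
  · exact ne_top_of_le_ne_top lintegral_Ioo_enorm_rpow_ne_top
      (lintegral_mono' (Measure.restrict_mono le_rfl hle) le_rfl)
  · refine ne_top_of_le_ne_top (ENNReal.one_ne_top) ?_
    calc ∫⁻ t in (Set.Ioo (-1 : ℝ) 1)ᶜ, ‖t‖ₑ ^ (-(1 / 2) : ℝ) ∂gaussianReal 0 1
        ≤ ∫⁻ t in (Set.Ioo (-1 : ℝ) 1)ᶜ, 1 ∂gaussianReal 0 1 := by
          refine setLIntegral_mono' measurableSet_Ioo.compl fun t ht => ?_
          rw [ENNReal.rpow_neg]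
          refine ENNReal.inv_le_one.2 (ENNReal.one_le_rpow ?_ (by norm_num))
          rw [Real.enorm_eq_ofReal_abs, ← ENNReal.ofReal_one]
          refine ENNReal.ofReal_le_ofReal ?_
          by_contra! h
          exact ht (abs_lt.1 h)
      _ ≤ 1 := by simpa using prob_le_one

/-- Since `0 * ∞ = 0`, this is what makes the next bound on linear forms trivially true when `L v =
0`. -/
lemma gaussianNegMoment_ne_zero : gaussianNegMoment ≠ 0 := by
  intro h
  rw [gaussianNegMoment, lintegral_eq_zero_iff (by fun_prop)] at h
  obtain ⟨t, ht⟩ := h.exists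
  norm_num [ENNReal.rpow_eq_zero_iff] at ht

/-- Under the standard Gaussian law `f` is a centred normal variable of standard deviation ‖f‖, so
the claim is homogeneity. -/
lemma lintegral_strongDual_stdGaussian_rpow {E : Type*} [NormedAddCommGroup E]
    [InnerProductSpace ℝ E] [FiniteDimensional ℝ E] [MeasurableSpace E] [BorelSpace E]
    (f : StrongDual ℝ E) :
    ∫⁻ z, ‖f z‖ₑ ^ (-(1 / 2) : ℝ) ∂stdGaussian E
      = ‖f‖ₑ ^ (-(1 / 2) : ℝ) * gaussianNegMoment := by
  have h1 : (stdGaussian E).map f = (gaussianReal 0 1).map (‖f‖ * ·) := by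
    rw [IsGaussian.map_eq_gaussianReal, gaussianReal_map_const_mul, integral_strongDual_stdGaussian,
      variance_dual_stdGaussian, mul_zero, mul_one]
    congr 1
    exact Real.toNNReal_of_nonneg (sq_nonneg _)
  calc ∫⁻ z, ‖f z‖ₑ ^ (-(1 / 2) : ℝ) ∂stdGaussian E
      = ∫⁻ t, ‖t‖ₑ ^ (-(1 / 2) : ℝ) ∂((stdGaussian E).map f) := by
        rw [lintegral_map (by fun_prop) (by fun_prop)]
    _ = ∫⁻ t, ‖f‖ₑ ^ (-(1 / 2) : ℝ) * ‖t‖ₑ ^ (-(1 / 2) : ℝ) ∂gaussianReal 0 1 := by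
        rw [h1, lintegral_map (by fun_prop) (by fun_prop)]
        refine lintegral_congr fun t => ?_
        rw [enorm_mul, enorm_norm, ENNReal.mul_rpow_of_ne_top enorm_ne_top enorm_ne_top]
    _ = _ := by rw [lintegral_const_mul _ (by fun_prop), gaussianNegMoment]

variable {K : Type*} [RCLike K] {d : ℕ}

lemma lintegral_linearMap_stdGaussian_rpow_le
    (L : EuclideanSpace K (Fin d) →ₗ[K] K) {v : EuclideanSpace K (Fin d)} (hv : ‖v‖ = 1) :
    ∫⁻ z, ‖L z‖ₑ ^ (-(1 / 2) : ℝ) ∂stdGaussian (EuclideanSpace K (Fin d))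
      ≤ gaussianNegMoment * ‖L v‖ₑ ^ (-(1 / 2) : ℝ) := by
  by_cases hL : L v = 0
  · rw [hL, enorm_zero, ENNReal.zero_rpow_of_neg (by norm_num),
      ENNReal.mul_top gaussianNegMoment_ne_zero]
    exact le_top
  have hL' : ‖L v‖ ≠ 0 := norm_ne_zero_iff.2 hL
  -- This phase makes u L(v) real and positive. The real form f = Re(uL) then satisfies |f| ≤ |L|
  -- and ‖f‖ ≥ ‖L v‖, and a negative exponent reverses both inequalities in the useful direction.
  set u : K := (starRingEnd K) (L v) * (‖L v‖ : K)⁻¹ with hu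
  have hu1 : ‖u‖ = 1 := by simp [hu, hL]
  set f : StrongDual ℝ (EuclideanSpace K (Fin d)) :=
    LinearMap.toContinuousLinearMap (RCLike.reLm ∘ₗ (u • L).restrictScalars ℝ) with hf
  have hfa : ∀ z, f z = RCLike.re (u * L z) := fun z => rfl
  have hfv : f v = ‖L v‖ := by
    have h : u * L v = ((‖L v‖ : ℝ) : K) := by
      rw [hu, mul_right_comm, RCLike.conj_mul]
      have : (‖L v‖ : K) ≠ 0 := by exact_mod_cast hL'
      field_simp
    rw [hfa, h, RCLike.ofReal_re]
  have hfz : ∀ z, ‖f z‖ₑ ≤ ‖L z‖ₑ := by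
    intro z
    rw [enorm_le_iff_norm_le, hfa, Real.norm_eq_abs]
    calc |RCLike.re (u * L z)| ≤ ‖u * L z‖ := RCLike.abs_re_le_norm _
      _ = ‖L z‖ := by rw [norm_mul, hu1, one_mul]
  have hfn : ‖L v‖ₑ ≤ ‖f‖ₑ := by
    rw [enorm_le_iff_norm_le]
    have := f.le_opNorm v
    rwa [hfv, hv, mul_one, norm_norm] at this
  have hanti : ∀ {a b : ℝ≥0∞}, a ≤ b → b ^ (-(1 / 2) : ℝ) ≤ a ^ (-(1 / 2) : ℝ) := by
    intro a b hab
    rw [ENNReal.rpow_neg, ENNReal.rpow_neg]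
    exact ENNReal.inv_le_inv.2 (ENNReal.rpow_le_rpow hab (by norm_num))
  calc _ ≤ ∫⁻ z, ‖f z‖ₑ ^ (-(1 / 2) : ℝ) ∂stdGaussian (EuclideanSpace K (Fin d)) :=
        lintegral_mono fun z => hanti (hfz z)
    _ = ‖f‖ₑ ^ (-(1 / 2) : ℝ) * gaussianNegMoment := lintegral_strongDual_stdGaussian_rpow f
    _ ≤ _ := by rw [mul_comm]; exact mul_le_mul_right (hanti hfn) _

/-- The Gaussian vectors are integrated out one at a time; each is replaced by the fixed unit vector
`v i` at the cost of one factor `gaussianNegMoment`. Only the inequality half of Tonelli is used, so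
no measurability of the integrand is needed. -/
lemma lintegral_multilinearMap_stdGaussian_rpow_le (m : ℕ)
    (M : MultilinearMap K (fun _ : Fin m => EuclideanSpace K (Fin d)) K)
    {v : Fin m → EuclideanSpace K (Fin d)} (hv : ∀ i, ‖v i‖ = 1) :
    ∫⁻ Z, ‖M Z‖ₑ ^ (-(1 / 2) : ℝ)
        ∂Measure.pi (fun _ : Fin m => stdGaussian (EuclideanSpace K (Fin d)))
      ≤ gaussianNegMoment ^ m * ‖M v‖ₑ ^ (-(1 / 2) : ℝ) := by
  induction m with
  | zero =>
    have : ∀ Z, M Z = M v := fun Z => congrArg M (Subsingleton.elim _ _)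
    simp [this]
  | succ m ih =>
    set γ := stdGaussian (EuclideanSpace K (Fin d))
    have h1 := (measurePreserving_piFinSuccAbove (fun _ : Fin (m + 1) => γ) 0).symm
    calc ∫⁻ Z, ‖M Z‖ₑ ^ (-(1 / 2) : ℝ) ∂Measure.pi (fun _ : Fin (m + 1) => γ)
        = ∫⁻ p, ‖M (Fin.cons p.1 p.2)‖ₑ ^ (-(1 / 2) : ℝ)
            ∂γ.prod (Measure.pi fun _ : Fin m => γ) := by
          rw [← h1.lintegral_comp_emb (MeasurableEquiv.measurableEmbedding _)]
          refine lintegral_congr fun p => ?_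
          congr 3
          exact Fin.insertNth_zero' p.1 p.2
      _ ≤ ∫⁻ z, ∫⁻ Z, ‖M.curryLeft z Z‖ₑ ^ (-(1 / 2) : ℝ) ∂(Measure.pi fun _ : Fin m => γ) ∂γ :=
          lintegral_prod_le _
      _ ≤ ∫⁻ z, gaussianNegMoment ^ m * ‖M.curryLeft z (Fin.tail v)‖ₑ ^ (-(1 / 2) : ℝ) ∂γ :=
          lintegral_mono fun z => ih (M.curryLeft z) fun i => hv _
      _ = gaussianNegMoment ^ m *
            ∫⁻ z, ‖M.toLinearMap v 0 z‖ₑ ^ (-(1 / 2) : ℝ) ∂γ := by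
          rw [lintegral_const_mul' _ _ (ENNReal.pow_ne_top gaussianNegMoment_ne_top)]
          congr 2 with z
          have : Fin.cons z (Fin.tail v) = Function.update v 0 z := by
            rw [← Fin.cons_self_tail v, Fin.update_cons_zero, Fin.tail_cons]
          rw [MultilinearMap.curryLeft_apply, MultilinearMap.toLinearMap_apply, this]
      _ ≤ gaussianNegMoment ^ m *
            (gaussianNegMoment * ‖M.toLinearMap v 0 (v 0)‖ₑ ^ (-(1 / 2) : ℝ)) := by
          gcongr
          exact lintegral_linearMap_stdGaussian_rpow_le _ (hv 0)
      _ = _ := by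
          rw [MultilinearMap.toLinearMap_apply, Function.update_eq_self, pow_succ, mul_assoc]

/-- The matrix whose columns are the given vectors. -/
def colMatrix {n : ℕ} (Z : Fin n → EuclideanSpace K (Fin d)) : Matrix (Fin d) (Fin n) K :=
  Matrix.of fun a i => Z i a

/-- The determinant is multilinear in the columns and equals 1 on the standard basis. -/
lemma lintegral_det_colMatrix_rpow_ne_top :
    ∫⁻ Z, ‖(colMatrix Z).det‖ₑ ^ (-(1 / 2) : ℝ)
        ∂Measure.pi (fun _ : Fin d => stdGaussian (EuclideanSpace K (Fin d))) ≠ ∞ := by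
  set M : MultilinearMap K (fun _ : Fin d => EuclideanSpace K (Fin d)) K :=
    (detRowAlternating (n := Fin d) (R := K)).toMultilinearMap.compLinearMap
      (fun _ => (WithLp.linearEquiv 2 K (Fin d → K)).toLinearMap) with hM
  have hMZ : ∀ Z, M Z = (colMatrix Z).det := fun Z => by
    rw [← det_transpose]; rfl
  have h := lintegral_multilinearMap_stdGaussian_rpow_le d M
    (v := fun i => EuclideanSpace.single i (1 : K)) (by simp)
  simp only [hMZ] at h
  refine ne_top_of_le_ne_top ?_ h
  have : colMatrix (fun i => EuclideanSpace.single i (1 : K)) = (1 : Matrix (Fin d) (Fin d) K) := by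
    ext a i
    simp [colMatrix, Matrix.one_apply]
  rw [this, det_one]
  simpa using ENNReal.pow_ne_top gaussianNegMoment_ne_top

end NegativeMoments

/-! ### Monotonicity of the determinant and Gram matrices -/

section Determinants

variable {K : Type*} [RCLike K] {d : ℕ}

lemma one_le_det_one_add {P : Matrix (Fin d) (Fin d) K} (hP : P.PosSemidef) :
    1 ≤ RCLike.re (1 + P).det := by
  obtain ⟨V, q, hV, hV', hq, hQ, -⟩ := exists_spectral (PosDef.one.add_posSemidef hP)
  have hq1 : ∀ i, 1 ≤ q i := by
    have h := hP.conjTranspose_mul_mul_same V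
    have e : Vᴴ * P * V = realDiag (fun i => q i - 1) := by
      have e1 : P = V * realDiag q * Vᴴ - 1 := by rw [← hQ]; abel
      have e2 : Vᴴ * (V * realDiag q * Vᴴ) * V = (realDiag q : Matrix (Fin d) (Fin d) K) := by
        rw [show Vᴴ * (V * realDiag q * Vᴴ) * V = (Vᴴ * V) * realDiag q * (Vᴴ * V) by
          simp only [Matrix.mul_assoc], hV, Matrix.one_mul, Matrix.mul_one]
      rw [e1, Matrix.mul_sub, Matrix.sub_mul, e2, Matrix.mul_one, hV, ← realDiag_one]
      ext i j
      by_cases hij : i = j <;> simp [realDiag, hij]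
    rw [e, realDiag, posSemidef_diagonal_iff] at h
    intro i
    have := h i
    have h2 : (0 : ℝ) ≤ q i - 1 := by exact_mod_cast this
    linarith
  have hdet : (1 + P).det = ((∏ i, q i : ℝ) : K) := by
    rw [hQ, det_mul_comm, ← Matrix.mul_assoc, hV, Matrix.one_mul, realDiag, det_diagonal]
    push_cast; rfl
  rw [hdet, RCLike.ofReal_re]
  exact Finset.one_le_prod fun i _ => hq1 i

lemma re_det_nonneg {A : Matrix (Fin d) (Fin d) K} (hA : A.PosSemidef) :
    0 ≤ RCLike.re A.det :=
  (RCLike.nonneg_iff.1 hA.det_nonneg).1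

lemma norm_det_eq_re {A : Matrix (Fin d) (Fin d) K} (hA : A.PosSemidef) :
    ‖A.det‖ = RCLike.re A.det := by
  have := RCLike.norm_of_nonneg' hA.det_nonneg
  rw [← this, RCLike.ofReal_re, norm_algebraMap', norm_norm]

/-- For invertible A = S², the sum factors as S(1 + S⁻¹BS⁻¹)S, and the middle factor has determinant
at least 1. -/
lemma re_det_le_re_det_add {A B : Matrix (Fin d) (Fin d) K} (hA : A.PosSemidef)
    (hB : B.PosSemidef) : RCLike.re A.det ≤ RCLike.re (A + B).det := by
  by_cases h0 : A.det = 0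
  · rw [h0, map_zero]; exact re_det_nonneg (hA.add hB)
  have hA' : A.PosDef := hA.posDef_iff_det_ne_zero.2 h0
  obtain ⟨h1, h2, h3⟩ := sqrt_spec hA'
  have h3' : IsUnit (CFC.sqrt A).det := (isUnit_iff_isUnit_det _).1 h3
  set S := CFC.sqrt A
  have hP : (S⁻¹ * B * S⁻¹).PosSemidef := by
    have := hB.mul_mul_conjTranspose_same S⁻¹
    rwa [conjTranspose_nonsing_inv, h1] at this
  have e : A + B = S * (1 + S⁻¹ * B * S⁻¹) * S := by
    rw [Matrix.mul_add, Matrix.add_mul, Matrix.mul_one, h2]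
    congr 1
    rw [show S * (S⁻¹ * B * S⁻¹) * S = (S * S⁻¹) * B * (S⁻¹ * S) by simp only [Matrix.mul_assoc],
      mul_nonsing_inv _ h3', nonsing_inv_mul _ h3', Matrix.one_mul, Matrix.mul_one]
  have hd : (A + B).det = A.det * (1 + S⁻¹ * B * S⁻¹).det := by
    rw [e, det_mul, det_mul, mul_right_comm, ← det_mul S S, h2]
  have h4 : (1 + S⁻¹ * B * S⁻¹).PosSemidef := PosSemidef.one.add hP
  rw [← norm_det_eq_re hA, ← norm_det_eq_re (hA.add hB), hd, norm_mul]
  exact le_mul_of_one_le_right (norm_nonneg _) ((one_le_det_one_add hP).trans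
    (norm_det_eq_re h4).ge)

/-- The matrix `Z₁ Z₁^* + ⋯ + Zₙ Zₙ^*`. -/
def gram {n : ℕ} (Z : Fin n → EuclideanSpace K (Fin d)) : Matrix (Fin d) (Fin d) K :=
  ∑ i, vecMulVec (fun a => Z i a) (fun b => star (Z i b))

lemma gram_eq_mul {n : ℕ} (Z : Fin n → EuclideanSpace K (Fin d)) :
    gram Z = colMatrix Z * (colMatrix Z)ᴴ := by
  ext a b
  simp [gram, colMatrix, Matrix.mul_apply, Matrix.sum_apply, vecMulVec_apply]

lemma posSemidef_gram {n : ℕ} (Z : Fin n → EuclideanSpace K (Fin d)) : (gram Z).PosSemidef := by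
  rw [gram_eq_mul]; exact posSemidef_self_mul_conjTranspose _

/-- Discarding all but `d` vectors removes a positive semidefinite summand from the Gram matrix; the
square case then bounds the determinant from below. -/
lemma norm_det_colMatrix_sq_le {n : ℕ} (f : Fin d ↪ Fin n) (Z : Fin n → EuclideanSpace K (Fin d)) :
    ‖(colMatrix fun i => Z (f i)).det‖ ^ 2 ≤ ‖(gram Z).det‖ := by
  have h1 : gram Z = gram (fun i => Z (f i))
      + ∑ i ∈ (Finset.univ.map f)ᶜ, vecMulVec (fun a => Z i a) (fun b => star (Z i b)) := by
    rw [gram, ← Finset.sum_add_sum_compl (Finset.univ.map f), Finset.sum_map, gram]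
  have h2 : ‖(gram fun i => Z (f i)).det‖ = ‖(colMatrix fun i => Z (f i)).det‖ ^ 2 := by
    rw [gram_eq_mul, det_mul, det_conjTranspose, norm_mul, norm_star, sq]
  rw [← h2, norm_det_eq_re (posSemidef_gram _), norm_det_eq_re (posSemidef_gram _), h1]
  refine re_det_le_re_det_add (posSemidef_gram _) (posSemidef_sum _ fun i _ => ?_)
  exact posSemidef_vecMulVec_self_star _

end Determinants

/-! ### Measurability of the functional calculus, the distance and the action -/

section Measurability

variable {K : Type*} [RCLike K] {d : ℕ}

lemma measurable_matrix_iff {α : Type*} [MeasurableSpace α] {F : α → Matrix (Fin d) (Fin d) K} :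
    Measurable F ↔ ∀ i j, Measurable fun a => F a i j := by
  refine ⟨fun h i j => ?_, fun h => ?_⟩
  · exact (measurable_pi_apply j).comp ((measurable_pi_apply i).comp h)
  · exact measurable_pi_lambda _ fun i => measurable_pi_lambda _ fun j => h i j

/-- The set is the closed cone of positive semidefinite matrices intersected with the open set of
nonzero determinant. -/
lemma measurableSet_posDef : MeasurableSet {X : Matrix (Fin d) (Fin d) K | X.PosDef} := by
  have h1 : {X : Matrix (Fin d) (Fin d) K | X.PosDef}
      = ({X | X.IsHermitian} ∩ ⋂ x : Fin d → K, {X | 0 ≤ RCLike.re (star x ⬝ᵥ (X *ᵥ x))} ∩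
          {X | RCLike.im (star x ⬝ᵥ (X *ᵥ x)) = 0}) ∩ {X | X.det ≠ 0} := by
    ext X
    simp only [Set.mem_ofPred_eq, Set.mem_inter_iff, Set.mem_iInter]
    constructor
    · intro h
      refine ⟨⟨h.1, fun x => ?_⟩, h.det_pos.ne'⟩
      exact RCLike.nonneg_iff.1 (h.posSemidef.dotProduct_mulVec_nonneg x)
    · rintro ⟨⟨h2, h3⟩, h4⟩
      exact (posSemidef_iff_dotProduct_mulVec.2
        ⟨h2, fun x => RCLike.nonneg_iff.2 (h3 x)⟩).posDef_iff_det_ne_zero.2 h4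
  rw [h1]
  refine MeasurableSet.inter (IsClosed.measurableSet ?_) (IsOpen.measurableSet ?_)
  · refine (isClosed_eq (by fun_prop) (by fun_prop)).inter (isClosed_iInter fun x => ?_)
    have hc : Continuous fun X : Matrix (Fin d) (Fin d) K => star x ⬝ᵥ (X *ᵥ x) := by fun_prop
    exact (isClosed_le continuous_const (RCLike.continuous_re.comp hc)).inter
      (isClosed_eq (RCLike.continuous_im.comp hc) continuous_const)
  · exact isOpen_ne_fun (by fun_prop) continuous_const

lemma measurable_normFactor : Measurable (normFactor : Matrix (Fin d) (Fin d) K → ℝ) := by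
  have h : Continuous fun X : Matrix (Fin d) (Fin d) K => RCLike.re X.det :=
    RCLike.continuous_re.comp (by fun_prop)
  exact h.measurable.pow_const _

open Classical in
/-- The normalization `π`, extended to all matrices. -/
def toUnitDet (X : Matrix (Fin d) (Fin d) K) : UnitDet K d :=
  if h : X.PosDef then proj ⟨X, h⟩ else 1

lemma toUnitDet_of_posDef {X : Matrix (Fin d) (Fin d) K} (h : X.PosDef) :
    toUnitDet X = proj ⟨X, h⟩ := dif_pos h

lemma measurable_toUnitDet :
    Measurable (toUnitDet : Matrix (Fin d) (Fin d) K → UnitDet K d) := by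
  classical
  have h : Measurable fun X : Matrix (Fin d) (Fin d) K => (toUnitDet X).1 := by
    have e : (fun X : Matrix (Fin d) (Fin d) K => (toUnitDet X).1)
        = fun X => if X.PosDef then normFactor X • X else 1 := by
      ext1 X
      by_cases hX : X.PosDef
      · rw [toUnitDet_of_posDef hX, if_pos hX]; rfl
      · rw [toUnitDet, dif_neg hX, if_neg hX]; rfl
    rw [e]
    refine Measurable.ite measurableSet_posDef (measurable_matrix_iff.2 fun i j => ?_)
      measurable_const
    simp only [Matrix.smul_apply]
    exact measurable_normFactor.smul (measurable_matrix_iff.1 measurable_id i j)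
  exact h.subtype_mk

lemma measurable_cfc {α : Type*} [MeasurableSpace α] {F : α → Matrix (Fin d) (Fin d) K}
    (hF : Measurable F) (hpos : ∀ a, (F a).PosDef) {f : ℝ → ℝ} (hf : ContinuousOn f (Set.Ioi 0)) :
    Measurable fun a => cfc f (F a) := by
  -- These intervals exhaust (0, ∞), so the polynomials converge to `f` at every eigenvalue.
  -- Polynomials act continuously on matrices, and a pointwise limit of measurable functions is
  -- measurable.
  have hp : ∀ k : ℕ, ∃ p : Polynomial ℝ, ∀ x ∈ Set.Icc ((k + 1 : ℝ)⁻¹) (k + 1),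
      |p.eval x - f x| < (k + 1 : ℝ)⁻¹ := fun k =>
    exists_polynomial_near_of_continuousOn _ _ f
      (hf.mono fun x hx => lt_of_lt_of_le (by positivity) hx.1) _ (by positivity)
  choose p hp using hp
  rw [measurable_matrix_iff]
  intro i j
  refine measurable_of_tendsto_metrizable (f := fun k a => (cfc (fun x => (p k).eval x) (F a)) i j)
    (fun k => ?_) ?_
  · refine measurable_matrix_iff.1 ?_ i j
    have : (fun a => cfc (fun x => (p k).eval x) (F a))
        = fun a => Polynomial.aeval (F a) (p k) := by
      ext1 a
      exact cfc_polynomial (p k) (F a) (hpos a).1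
    rw [this]
    have hc : Continuous fun X : Matrix (Fin d) (Fin d) K => Polynomial.aeval X (p k) := by
      simp only [Polynomial.aeval_eq_sum_range]
      fun_prop
    exact hc.measurable.comp hF
  · rw [tendsto_pi_nhds]
    intro a
    obtain ⟨U, z, hU, hU', hz, -, hfz⟩ := exists_spectral (hpos a)
    have hlim : ∀ l, Filter.Tendsto (fun k => (p k).eval (z l)) Filter.atTop (nhds (f (z l))) := by
      intro l
      rw [tendsto_iff_norm_sub_tendsto_zero]
      refine squeeze_zero' (Filter.Eventually.of_forall fun k => norm_nonneg _) ?_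
        (tendsto_one_div_add_atTop_nhds_zero_nat (𝕜 := ℝ))
      have e1 : ∀ᶠ k : ℕ in Filter.atTop, z l ≤ k + 1 := by
        filter_upwards [tendsto_natCast_atTop_atTop.eventually_ge_atTop (z l)] with k hk
        linarith
      have e2 : ∀ᶠ k : ℕ in Filter.atTop, (k + 1 : ℝ)⁻¹ ≤ z l := by
        filter_upwards [tendsto_natCast_atTop_atTop.eventually_ge_atTop (z l)⁻¹] with k hk
        exact inv_le_of_inv_le₀ (hz l) (by linarith)
      filter_upwards [e1, e2] with k h1 h2
      rw [one_div]
      exact (hp k _ ⟨h2, h1⟩).le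
    simp only [hfz]
    have hc : Continuous fun b : Fin d → ℝ =>
        (U * realDiag b * Uᴴ : Matrix (Fin d) (Fin d) K) i j := by
      unfold realDiag
      refine Continuous.matrix_elem ?_ i j
      have : Continuous fun b : Fin d → ℝ => (fun i => (b i : K)) :=
        continuous_pi fun i => RCLike.continuous_ofReal.comp (continuous_apply i)
      fun_prop
    exact (hc.tendsto _).comp (tendsto_pi_nhds.2 hlim)

lemma measurable_frobeniusNorm :
    Measurable (frobeniusNorm : Matrix (Fin d) (Fin d) K → ℝ) := by
  have : (frobeniusNorm : Matrix (Fin d) (Fin d) K → ℝ)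
      = fun A => √(∑ i, ∑ j, ‖A i j‖ ^ 2) := by
    ext A
    rw [← frobeniusNorm_sq, Real.sqrt_sq (frobeniusNorm_nonneg A)]
  rw [this]
  have : Continuous fun A : Matrix (Fin d) (Fin d) K => √(∑ i, ∑ j, ‖A i j‖ ^ 2) := by fun_prop
  exact this.measurable

lemma continuousOn_log_Ioi : ContinuousOn Real.log (Set.Ioi 0) :=
  Real.continuousOn_log.mono fun _ hx => ne_of_gt hx

lemma measurable_log_unitDet : Measurable fun y : UnitDet K d => cfc Real.log y.1 :=
  measurable_cfc measurable_subtype_coe (fun y => y.2.1) continuousOn_log_Ioi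

lemma measurable_affDist (c : ℝ) (x : UnitDet K d) : Measurable fun y => affDist c x y := by
  refine (measurable_frobeniusNorm.comp (measurable_cfc ?_
    (fun y => posDef_whiten x.2.1 y.2.1) continuousOn_log_Ioi)).const_mul c
  have : Continuous fun X : Matrix (Fin d) (Fin d) K =>
    (CFC.sqrt x.1)⁻¹ * X * (CFC.sqrt x.1)⁻¹ := by fun_prop
  exact this.measurable.comp measurable_subtype_coe

lemma measurable_act (g : GL (Fin d) K) : Measurable (act g) := by
  have h : act g = fun y => toUnitDet (g.1 * y.1 * (g.1)ᴴ) := by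
    ext1 y
    rw [toUnitDet_of_posDef (y.2.1.mul_mul_conjTranspose_of_isUnit g.isUnit)]
    rfl
  rw [h]
  have : Continuous fun X : Matrix (Fin d) (Fin d) K => g.1 * X * (g.1)ᴴ := by fun_prop
  exact measurable_toUnitDet.comp (this.measurable.comp measurable_subtype_coe)

lemma measurable_gram {n : ℕ} :
    Measurable (gram : (Fin n → EuclideanSpace K (Fin d)) → Matrix (Fin d) (Fin d) K) := by
  have : Continuous (gram : (Fin n → EuclideanSpace K (Fin d)) → Matrix (Fin d) (Fin d) K) := by
    unfold gram
    refine continuous_finsetSum _ fun i _ => ?_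
    refine continuous_matrix fun a b => ?_
    simp only [vecMulVec_apply]
    fun_prop
  exact this.measurable

end Measurability

/-! ### The law for covariance one, its symmetries, and reduction to it -/

section StandardLaw

variable {K : Type*} [RCLike K] {d n : ℕ}

variable (K d n) in
/-- The joint law of `n` independent standard Gaussian vectors of `K^d`. -/
def gaussianSample : Measure (Fin n → EuclideanSpace K (Fin d)) :=
  Measure.pi fun _ => stdGaussian (EuclideanSpace K (Fin d))

instance : IsProbabilityMeasure (gaussianSample K d n) := by
  unfold gaussianSample; infer_instance

variable (K d n) in
/-- The law of `π(Z₁ Z₁^* + ⋯ + Zₙ Zₙ^*)` for independent standard Gaussian `Zᵢ`. -/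
def stdLaw : Measure (UnitDet K d) := (gaussianSample K d n).map fun Z => toUnitDet (gram Z)

lemma measurable_toUnitDet_gram :
    Measurable fun Z : Fin n → EuclideanSpace K (Fin d) => toUnitDet (gram Z) :=
  measurable_toUnitDet.comp measurable_gram

instance : IsProbabilityMeasure (stdLaw K d n) :=
  Measure.isProbabilityMeasure_map measurable_toUnitDet_gram.aemeasurable

lemma gaussianSample_map_comp (f : Fin d ↪ Fin n) :
    (gaussianSample K d n).map (fun Z i => Z (f i)) = gaussianSample K d d := by
  have h := (iIndepFun_pi (μ := fun _ : Fin n => stdGaussian (EuclideanSpace K (Fin d)))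
    (X := fun _ z => z) (fun _ => aemeasurable_id)).precomp f.injective
  have h2 := (iIndepFun_iff_map_fun_eq_pi_map
    (fun i => (measurable_pi_apply (f i)).aemeasurable)).1 h
  rw [gaussianSample, gaussianSample]
  refine h2.trans ?_
  congr 1
  ext1 i
  exact (measurePreserving_eval
    (fun _ : Fin n => stdGaussian (EuclideanSpace K (Fin d))) (f i)).map_eq

/-- The exponent is half of −1/2 because the Gram determinant dominates the square of a `d × d`
minor, available as soon as `d ≤ n`. -/
lemma lintegral_det_gram_rpow_ne_top (hn : d ≤ n) :
    ∫⁻ Z, ‖(gram Z).det‖ₑ ^ (-(1 / 4) : ℝ) ∂gaussianSample K d n ≠ ∞ := by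
  set f : Fin d ↪ Fin n := Fin.castLEEmb hn
  have hm : Measurable fun Z : Fin d → EuclideanSpace K (Fin d) =>
      ‖(colMatrix Z).det‖ₑ ^ (-(1 / 2) : ℝ) := by
    have : Continuous fun Z : Fin d → EuclideanSpace K (Fin d) => (colMatrix Z).det := by
      refine Continuous.matrix_det (continuous_matrix fun a b => ?_)
      simp only [colMatrix, of_apply]
      fun_prop
    exact this.measurable.enorm.pow_const _
  have h := lintegral_det_colMatrix_rpow_ne_top (K := K) (d := d)
  rw [← gaussianSample] at h
  rw [← gaussianSample_map_comp f, lintegral_map hm (by fun_prop)] at h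
  refine ne_top_of_le_ne_top h (lintegral_mono fun Z => ?_)
  have h1 : ‖(colMatrix fun i => Z (f i)).det‖ₑ ^ (2 : ℝ) ≤ ‖(gram Z).det‖ₑ := by
    rw [ENNReal.rpow_ofNat, ← enorm_pow, enorm_le_iff_norm_le, norm_pow]
    exact norm_det_colMatrix_sq_le f Z
  calc ‖(gram Z).det‖ₑ ^ (-(1 / 4) : ℝ)
      ≤ (‖(colMatrix fun i => Z (f i)).det‖ₑ ^ (2 : ℝ)) ^ (-(1 / 4) : ℝ) := by
        rw [ENNReal.rpow_neg, ENNReal.rpow_neg]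
        exact ENNReal.inv_le_inv.2 (ENNReal.rpow_le_rpow h1 (by norm_num))
    _ = _ := by rw [← ENNReal.rpow_mul]; norm_num

/-- The negative power would be infinite at a singular Gram matrix, so a finite moment rules these
out almost surely. -/
lemma ae_posDef_gram (hn : d ≤ n) :
    ∀ᵐ Z ∂gaussianSample K d n, (gram Z).PosDef := by
  have hm : Measurable fun Z : Fin n → EuclideanSpace K (Fin d) =>
      ‖(gram Z).det‖ₑ ^ (-(1 / 4) : ℝ) := by
    have : Continuous fun X : Matrix (Fin d) (Fin d) K => X.det := by fun_prop
    exact (this.measurable.comp measurable_gram).enorm.pow_const _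
  filter_upwards [ae_lt_top hm (lintegral_det_gram_rpow_ne_top hn)] with Z hZ
  refine (posSemidef_gram Z).posDef_iff_det_ne_zero.2 fun h => ?_
  rw [h, enorm_zero, ENNReal.zero_rpow_of_neg (by norm_num)] at hZ
  exact lt_irrefl _ hZ

lemma colMatrix_toEuclideanCLM (A : Matrix (Fin d) (Fin d) K)
    (Z : Fin n → EuclideanSpace K (Fin d)) :
    colMatrix (fun i => toEuclideanCLM (𝕜 := K) A (Z i)) = A * colMatrix Z := by
  ext a i
  simp [colMatrix, Matrix.mul_apply, ofLp_toEuclideanCLM, mulVec, dotProduct]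

lemma gram_toEuclideanCLM (A : Matrix (Fin d) (Fin d) K)
    (Z : Fin n → EuclideanSpace K (Fin d)) :
    gram (fun i => toEuclideanCLM (𝕜 := K) A (Z i)) = A * gram Z * Aᴴ := by
  rw [gram_eq_mul, gram_eq_mul, colMatrix_toEuclideanCLM, conjTranspose_mul]
  simp only [Matrix.mul_assoc]

lemma gram_smul (r : ℝ) (Z : Fin n → EuclideanSpace K (Fin d)) :
    gram (fun i => r • Z i) = (r ^ 2) • gram Z := by
  ext a b
  simp only [gram, Matrix.sum_apply, vecMulVec_apply, Matrix.smul_apply, PiLp.smul_apply,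
    Finset.smul_sum]
  refine Finset.sum_congr rfl fun i _ => ?_
  simp only [RCLike.real_smul_eq_coe_mul, RCLike.star_def, map_mul, RCLike.conj_ofReal]
  push_cast; ring

/-- Normalization absorbs positive scalars; in particular the factor that distinguishes real from
complex Gaussian vectors has no effect on the projective law. -/
lemma toUnitDet_smul_conj {r : ℝ} (hr : 0 < r) (g : GL (Fin d) K) {X : Matrix (Fin d) (Fin d) K}
    (hX : X.PosDef) : toUnitDet (r • (g.1 * X * (g.1)ᴴ)) = act g (toUnitDet X) := by
  have h1 := hX.mul_mul_conjTranspose_of_isUnit g.isUnit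
  rw [toUnitDet_of_posDef hX, toUnitDet_of_posDef (h1.smul hr)]
  obtain ⟨s, hs, e⟩ := exists_coe_act g (proj ⟨X, hX⟩)
  refine unitDet_eq_of_smul (Z := g.1 * X * (g.1)ᴴ)
    (mul_pos (normFactor_pos (h1.smul hr)) hr) (mul_pos hs (normFactor_pos hX)) ?_ ?_
  · simp only [proj, mul_smul]
  · rw [e]
    simp only [proj, mul_smul, Matrix.mul_smul, Matrix.smul_mul]

lemma toUnitDet_conj (g : GL (Fin d) K) {X : Matrix (Fin d) (Fin d) K}
    (hX : X.PosDef) : toUnitDet (g.1 * X * (g.1)ᴴ) = act g (toUnitDet X) := by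
  simpa using toUnitDet_smul_conj one_pos g hX

/-- The square root of a positive definite matrix, as an invertible matrix. -/
def sqrtGL (C : PosDefMat K d) : GL (Fin d) K := (sqrt_spec C.2).2.2.unit

lemma coe_sqrtGL (C : PosDefMat K d) : (sqrtGL C).1 = CFC.sqrt C.1 := rfl

lemma sqrtGL_mul_conjTranspose (C : PosDefMat K d) : (sqrtGL C).1 * ((sqrtGL C).1)ᴴ = C.1 := by
  rw [coe_sqrtGL, (sqrt_spec C.2).1, (sqrt_spec C.2).2.1]

lemma act_sqrtGL_one (C : PosDefMat K d) : act (sqrtGL C) 1 = proj C := by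
  rw [act]
  congr 1
  refine Subtype.ext ?_
  change (sqrtGL C).1 * 1 * ((sqrtGL C).1)ᴴ = C.1
  rw [Matrix.mul_one, sqrtGL_mul_conjTranspose]

lemma proj_coe (x : UnitDet K d) : proj ⟨x.1, x.2.1⟩ = x :=
  unitDet_eq_of_smul (normFactor_pos x.2.1) one_pos rfl (one_smul _ _).symm

lemma exists_act_one_eq (x : UnitDet K d) : ∃ g : GL (Fin d) K, act g 1 = x :=
  ⟨sqrtGL ⟨x.1, x.2.1⟩, by rw [act_sqrtGL_one, proj_coe]⟩

lemma map_proj_comap_val {μ : Measure (Matrix (Fin d) (Fin d) K)} (h : ∀ᵐ X ∂μ, X.PosDef) :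
    (μ.comap (Subtype.val : PosDefMat K d → Matrix (Fin d) (Fin d) K)).map proj
      = μ.map toUnitDet := by
  have e : (proj : PosDefMat K d → UnitDet K d) = toUnitDet ∘ Subtype.val := by
    ext1 X
    exact (toUnitDet_of_posDef X.2).symm
  have hv : MeasurableEmbedding (Subtype.val : PosDefMat K d → Matrix (Fin d) (Fin d) K) :=
    MeasurableEmbedding.subtype_coe measurableSet_posDef
  rw [e, ← Measure.map_map measurable_toUnitDet measurable_subtype_coe, hv.map_comap,
    Measure.restrict_eq_self_of_ae_mem]
  filter_upwards [h] with X hX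
  exact ⟨⟨X, hX⟩, rfl⟩

lemma wishart_eq_map (C : PosDefMat K d) (n : ℕ) :
    wishart C.1 n = (gaussianSample K d n).map fun Z =>
      ((√(finrank ℝ K : ℝ))⁻¹ ^ 2) • ((sqrtGL C).1 * gram Z * ((sqrtGL C).1)ᴴ) := by
  have hm : Measurable fun z : EuclideanSpace K (Fin d) =>
      (√(finrank ℝ K : ℝ))⁻¹ • toEuclideanCLM (𝕜 := K) (CFC.sqrt C.1) z := by fun_prop
  have : IsProbabilityMeasure ((stdGaussian (EuclideanSpace K (Fin d))).map fun z =>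
      (√(finrank ℝ K : ℝ))⁻¹ • toEuclideanCLM (𝕜 := K) (CFC.sqrt C.1) z) :=
    Measure.isProbabilityMeasure_map hm.aemeasurable
  unfold wishart gaussianLaw
  rw [← Measure.pi_map_pi (fun _ => hm.aemeasurable)]
  change Measure.map gram _ = _
  have hm' : Measurable fun (Z : Fin n → EuclideanSpace K (Fin d)) i =>
      (√(finrank ℝ K : ℝ))⁻¹ • toEuclideanCLM (𝕜 := K) (CFC.sqrt C.1) (Z i) :=
    measurable_pi_lambda _ fun i => hm.comp (measurable_pi_apply i)
  rw [Measure.map_map measurable_gram hm']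
  congr 1
  ext1 Z
  rw [Function.comp_apply, gram_smul, gram_toEuclideanCLM, coe_sqrtGL]

lemma projWishart_eq_map (hn : d ≤ n) (C : PosDefMat K d) :
    projWishart C n = (stdLaw K d n).map (act (sqrtGL C)) := by
  have hr : 0 < (√(finrank ℝ K : ℝ))⁻¹ ^ 2 := by
    have : 0 < finrank ℝ K := finrank_pos
    positivity
  have hm : Measurable fun Z : Fin n → EuclideanSpace K (Fin d) =>
      ((√(finrank ℝ K : ℝ))⁻¹ ^ 2) • ((sqrtGL C).1 * gram Z * ((sqrtGL C).1)ᴴ) := by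
    have : Continuous fun X : Matrix (Fin d) (Fin d) K =>
      ((√(finrank ℝ K : ℝ))⁻¹ ^ 2) • ((sqrtGL C).1 * X * ((sqrtGL C).1)ᴴ) := by fun_prop
    exact this.measurable.comp measurable_gram
  rw [projWishart, map_proj_comap_val, wishart_eq_map, Measure.map_map measurable_toUnitDet hm,
    stdLaw, Measure.map_map (measurable_act _) measurable_toUnitDet_gram]
  · refine Measure.map_congr ?_
    filter_upwards [ae_posDef_gram hn] with Z hZ
    exact toUnitDet_smul_conj hr _ hZ
  · rw [wishart_eq_map, ae_map_iff hm.aemeasurable measurableSet_posDef]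
    filter_upwards [ae_posDef_gram hn] with Z hZ
    exact (hZ.mul_mul_conjTranspose_of_isUnit (sqrtGL C).isUnit).smul hr

/-- A unitary matrix as a real-linear isometry of `K^d`. -/
def unitaryIsometry (g : GL (Fin d) K) (hg : (g.1)ᴴ * g.1 = 1) :
    EuclideanSpace K (Fin d) ≃ₗᵢ[ℝ] EuclideanSpace K (Fin d) :=
  LinearIsometry.toLinearIsometryEquiv
    { toLinearMap := (toEuclideanCLM (𝕜 := K) g.1).toLinearMap.restrictScalars ℝ
      norm_map' := fun z => by
        change ‖toEuclideanCLM (𝕜 := K) g.1 z‖ = ‖z‖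
        refine ContinuousLinearMap.norm_map_iff_adjoint_comp_self _ |>.2 ?_ z
        rw [← ContinuousLinearMap.star_eq_adjoint, ← map_star, star_eq_conjTranspose,
          ← ContinuousLinearMap.mul_def, ← map_mul, hg, map_one] } rfl

/-- A unitary map is a real isometry of K^d, hence preserves the standard Gaussian law of each
sample vector. -/
lemma stdLaw_map_act (hn : d ≤ n) (g : GL (Fin d) K) (hg : (g.1)ᴴ * g.1 = 1) :
    (stdLaw K d n).map (act g) = stdLaw K d n := by
  have h1 : (gaussianSample K d n).map (fun Z i => toEuclideanCLM (𝕜 := K) g.1 (Z i))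
      = gaussianSample K d n :=
    (measurePreserving_pi (fun _ : Fin n => stdGaussian (EuclideanSpace K (Fin d)))
      (fun _ : Fin n => stdGaussian (EuclideanSpace K (Fin d)))
      (f := fun _ => toEuclideanCLM (𝕜 := K) g.1) fun _ =>
        ⟨by fun_prop, stdGaussian_map (unitaryIsometry g hg)⟩).map_eq
  conv_rhs => rw [stdLaw, ← h1]
  rw [stdLaw, Measure.map_map (measurable_act _) measurable_toUnitDet_gram,
    Measure.map_map measurable_toUnitDet_gram (by fun_prop)]
  refine Measure.map_congr ?_
  filter_upwards [ae_posDef_gram hn] with Z hZ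
  rw [Function.comp_apply, Function.comp_apply, gram_toEuclideanCLM, toUnitDet_conj g hZ]

end StandardLaw

/-! ### Finiteness of the Fréchet function -/

section Finiteness

variable {K : Type*} [RCLike K] {d n : ℕ}

lemma rpow_le_one_add {x p : ℝ} (hx : 0 ≤ x) (hp : 0 ≤ p) (hp1 : p ≤ 1) : x ^ p ≤ 1 + x := by
  rcases le_total x 1 with h | h
  · linarith [Real.rpow_le_one hx h hp]
  · have := Real.rpow_le_rpow_of_exponent_le h hp1
    rw [Real.rpow_one] at this
    linarith

/-- Every eigenvalue is at most the trace τ, and the logarithms of the eigenvalues sum to zero. So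
no logarithm can fall below minus the sum of the others, and each is at most d log τ in absolute
value. -/
lemma frobeniusNorm_log_sq_le_log_trace (hd : 1 ≤ d) (y : UnitDet K d) :
    1 ≤ RCLike.re y.1.trace ∧
    frobeniusNorm (cfc Real.log y.1) ^ 2 ≤ d * (d * Real.log (RCLike.re y.1.trace)) ^ 2 := by
  obtain ⟨V, z, hV, hV', hz, hy, hf⟩ := exists_spectral y.2.1
  have htr : RCLike.re y.1.trace = ∑ i, z i := by
    rw [hy, trace_mul_comm, ← Matrix.mul_assoc, hV, Matrix.one_mul, trace_realDiag,
      RCLike.ofReal_re]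
  have hprod : ∏ i, z i = 1 := by
    have h := y.2.2
    rw [hy, det_mul_comm, ← Matrix.mul_assoc, hV, Matrix.one_mul, realDiag, det_diagonal] at h
    exact_mod_cast h
  have hlog : ∑ i, Real.log (z i) = 0 := by
    rw [← Real.log_prod fun i _ => (hz i).ne', hprod, Real.log_one]
  have hle : ∀ i, z i ≤ ∑ i, z i := fun i =>
    Finset.single_le_sum (f := z) (fun j _ => (hz j).le) (Finset.mem_univ i)
  have h1 : 1 ≤ ∑ i, z i := by
    by_contra! h
    have : ∏ i, z i < ∏ _i : Fin d, (1 : ℝ) :=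
      Finset.prod_lt_prod_of_nonempty (fun i _ => hz i) (fun i _ => (hle i).trans_lt h)
        ⟨⟨0, hd⟩, Finset.mem_univ _⟩
    rw [hprod, Finset.prod_const_one] at this
    exact lt_irrefl _ this
  rw [htr]
  refine ⟨h1, ?_⟩
  set τ := ∑ i, z i
  have hτ : 0 ≤ Real.log τ := Real.log_nonneg h1
  have hup : ∀ i, Real.log (z i) ≤ Real.log τ := fun i => Real.log_le_log (hz i) (hle i)
  have hd' : (1 : ℝ) ≤ d := by exact_mod_cast hd
  have habs : ∀ i, |Real.log (z i)| ≤ d * Real.log τ := by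
    intro i
    rw [abs_le]
    constructor
    · have h2 : ∑ j ∈ Finset.univ.erase i, Real.log (z j) ≤ d * Real.log τ := by
        refine (Finset.sum_le_card_nsmul _ _ _ fun j _ => hup j).trans ?_
        rw [nsmul_eq_mul]
        refine mul_le_mul_of_nonneg_right ?_ hτ
        have := Finset.card_le_univ (Finset.univ.erase i)
        rw [Fintype.card_fin] at this
        exact_mod_cast this
      have h3 := Finset.add_sum_erase Finset.univ (fun j => Real.log (z j)) (Finset.mem_univ i)
      linarith
    · nlinarith [hup i]
  rw [hf, frobeniusNorm_conj_realDiag_sq hV]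
  calc ∑ i, Real.log (z i) ^ 2 ≤ ∑ _i : Fin d, (d * Real.log τ) ^ 2 :=
        Finset.sum_le_sum fun i _ => sq_le_sq' (by linarith [(abs_le.1 (habs i)).1])
          (abs_le.1 (habs i)).2
    _ = _ := by simp

lemma frobeniusNorm_log_toUnitDet_sq_le (hd : 1 ≤ d) {M : Matrix (Fin d) (Fin d) K}
    (hM : M.PosDef) :
    frobeniusNorm (cfc Real.log (toUnitDet M).1) ^ 2
      ≤ 256 * d ^ 3 * (2 + RCLike.re M.trace + ‖M.det‖ ^ (-(1 / 4) : ℝ)) := by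
  obtain ⟨h1, h2⟩ := frobeniusNorm_log_sq_le_log_trace hd (toUnitDet M)
  set τ := RCLike.re (toUnitDet M).1.trace with hτ
  set δ := ‖M.det‖ with hδ
  have hδ0 : 0 < δ := norm_pos_iff.2 hM.det_pos.ne'
  have hd' : (1 : ℝ) ≤ d := by exact_mod_cast hd
  have htr0 : 0 ≤ RCLike.re M.trace := (RCLike.nonneg_iff.1 hM.posSemidef.trace_nonneg).1
  have hτM : τ = δ ^ (-(1 / (d : ℝ))) * RCLike.re M.trace := by
    rw [hτ, toUnitDet_of_posDef hM]
    simp only [proj]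
    rw [trace_smul, RCLike.smul_re, normFactor, ← norm_det_eq_re hM.posSemidef]
  have h3 : Real.log τ ≤ 16 * τ ^ (1 / 16 : ℝ) := by
    have := Real.log_le_rpow_div (zero_le_one.trans h1) (ε := 1 / 16) (by norm_num)
    linarith
  have h4 : Real.log τ ^ 2 ≤ 256 * τ ^ (1 / 8 : ℝ) := by
    calc Real.log τ ^ 2 ≤ (16 * τ ^ (1 / 16 : ℝ)) ^ 2 :=
          pow_le_pow_left₀ (Real.log_nonneg h1) h3 2
      _ = 256 * (τ ^ (1 / 16 : ℝ)) ^ 2 := by ring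
      _ = _ := by
          rw [← Real.rpow_natCast, ← Real.rpow_mul (zero_le_one.trans h1)]
          norm_num
  -- The exponent 1/8 is chosen so that, after splitting τ^(1/8) = ab by ab ≤ (a² + b²)/2, the
  -- determinant appears as δ^(−1/(4d)). For every d ≥ 1 this is at most 1 + δ^(−1/4), whose moment
  -- is known to be finite.
  have h5 : τ ^ (1 / 8 : ℝ) ≤ 2 + RCLike.re M.trace + δ ^ (-(1 / 4) : ℝ) := by
    set a := (δ ^ (-(1 / 4) : ℝ)) ^ (1 / (2 * d) : ℝ) with ha
    set b := RCLike.re M.trace ^ (1 / 8 : ℝ) with hb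
    have e1 : τ ^ (1 / 8 : ℝ) = a * b := by
      rw [hτM, Real.mul_rpow (by positivity) htr0, ha, ← Real.rpow_mul hδ0.le,
        ← Real.rpow_mul hδ0.le]
      congr 2
      field_simp
      norm_num
    have e2 : a ^ 2 ≤ 1 + δ ^ (-(1 / 4) : ℝ) := by
      rw [ha, ← Real.rpow_natCast, ← Real.rpow_mul (by positivity)]
      refine rpow_le_one_add (by positivity) (by positivity) ?_
      rw [show 1 / (2 * (d : ℝ)) * (2 : ℕ) = (d : ℝ)⁻¹ by push_cast; field_simp]
      exact inv_le_one_of_one_le₀ hd'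
    have e3 : b ^ 2 ≤ 1 + RCLike.re M.trace := by
      rw [hb, ← Real.rpow_natCast, ← Real.rpow_mul htr0]
      exact rpow_le_one_add htr0 (by norm_num) (by norm_num)
    rw [e1]
    nlinarith [sq_nonneg (a - b), sq_nonneg (a + b)]
  calc _ ≤ (d : ℝ) * (d * Real.log τ) ^ 2 := h2
    _ = d ^ 3 * Real.log τ ^ 2 := by ring
    _ ≤ d ^ 3 * (256 * (2 + RCLike.re M.trace + δ ^ (-(1 / 4) : ℝ))) := by
        refine mul_le_mul_of_nonneg_left (h4.trans ?_) (by positivity)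
        linarith
    _ = _ := by ring

lemma re_trace_gram (Z : Fin n → EuclideanSpace K (Fin d)) :
    RCLike.re (gram Z).trace = ∑ i, ‖Z i‖ ^ 2 := by
  simp only [gram, trace_sum, map_sum]
  refine Finset.sum_congr rfl fun i _ => ?_
  rw [EuclideanSpace.norm_sq_eq]
  simp only [trace, diag_apply, vecMulVec_apply, RCLike.star_def, RCLike.mul_conj, map_sum]
  refine Finset.sum_congr rfl fun a _ => ?_
  rw [← RCLike.ofReal_pow, RCLike.ofReal_re]

lemma lintegral_re_trace_conj_gram_ne_top (A : Matrix (Fin d) (Fin d) K) :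
    ∫⁻ Z, ENNReal.ofReal (RCLike.re (A * gram Z * Aᴴ).trace) ∂gaussianSample K d n ≠ ∞ := by
  have hint : Integrable (fun Z : Fin n → EuclideanSpace K (Fin d) =>
      ∑ i, ‖toEuclideanCLM (𝕜 := K) A (Z i)‖ ^ 2) (gaussianSample K d n) := by
    refine integrable_finsetSum _ fun i _ => ?_
    have h1 : MemLp (fun z => toEuclideanCLM (𝕜 := K) A z) 2
        (stdGaussian (EuclideanSpace K (Fin d))) :=
      ((toEuclideanCLM (𝕜 := K) A).restrictScalars ℝ).comp_memLp' IsGaussian.memLp_two_id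
    exact (measurePreserving_eval (fun _ : Fin n => stdGaussian (EuclideanSpace K (Fin d)))
      i).integrable_comp_of_integrable (h1.integrable_norm_pow (by norm_num))
  have := hint.lintegral_lt_top.ne
  simpa only [← gram_toEuclideanCLM, re_trace_gram] using this

lemma affDist_act_left_sq (c : ℝ) (g : GL (Fin d) K) (x y : UnitDet K d) :
    affDist c (act g x) y ^ 2 = affDist c x (act g⁻¹ y) ^ 2 := by
  rw [← affDist_act_sq c g x (act g⁻¹ y), ← act_mul, mul_inv_cancel, act_one]

/-- Writing x = g · 1 moves the base point to 1, where the distance is c times the norm of a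
logarithm. The price is to replace the Gram matrix by its congruence under g⁻¹, which changes the
determinant only by a constant factor. -/
lemma frechetFunction_stdLaw_lt_top (hd : 1 ≤ d) (hn : d ≤ n) (c : ℝ) (x : UnitDet K d) :
    frechetFunction (affDist c) (stdLaw K d n) x < ∞ := by
  obtain ⟨g, rfl⟩ := exists_act_one_eq x
  set h := g⁻¹ with hh
  set k : ℝ := c ^ 2 * (256 * d ^ 3) with hk
  have hdet : h.1.det ≠ 0 := ((isUnit_iff_isUnit_det _).1 h.isUnit).ne_zero
  rw [frechetFunction, stdLaw,
    lintegral_map ((measurable_affDist c _).pow_const 2).ennreal_ofReal measurable_toUnitDet_gram]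
  have hbound : ∀ᵐ Z ∂gaussianSample K d n,
      ENNReal.ofReal (affDist c (act g 1) (toUnitDet (gram Z)) ^ 2)
        ≤ ENNReal.ofReal k * (2 + ENNReal.ofReal (RCLike.re (h.1 * gram Z * (h.1)ᴴ).trace)
          + ‖h.1.det * (h.1)ᴴ.det‖ₑ ^ (-(1 / 4) : ℝ) * ‖(gram Z).det‖ₑ ^ (-(1 / 4) : ℝ)) := by
    filter_upwards [ae_posDef_gram hn] with Z hZ
    have hM := hZ.mul_mul_conjTranspose_of_isUnit h.isUnit
    have h1 := frobeniusNorm_log_toUnitDet_sq_le hd hM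
    have htr := (RCLike.nonneg_iff.1 hM.posSemidef.trace_nonneg).1
    have hdM : (h.1 * gram Z * (h.1)ᴴ).det = h.1.det * (h.1)ᴴ.det * (gram Z).det := by
      rw [det_mul, det_mul]; ring
    have hpos : 0 < ‖(h.1 * gram Z * (h.1)ᴴ).det‖ := norm_pos_iff.2 hM.det_pos.ne'
    rw [affDist_act_left_sq, affDist_one_left, ← toUnitDet_conj _ hZ,
      ← ENNReal.mul_rpow_of_ne_top enorm_ne_top enorm_ne_top, ← enorm_mul, ← hdM,
      ← ofReal_norm, ENNReal.ofReal_rpow_of_pos hpos,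
      show (2 : ℝ≥0∞) = ENNReal.ofReal 2 by simp,
      ← ENNReal.ofReal_add (by norm_num) htr,
      ← ENNReal.ofReal_add (by linarith) (by positivity),
      ← ENNReal.ofReal_mul (by positivity)]
    refine ENNReal.ofReal_le_ofReal ?_
    rw [mul_pow, hk, mul_assoc (c ^ 2)]
    exact mul_le_mul_of_nonneg_left h1 (sq_nonneg c)
  refine (lintegral_mono_ae hbound).trans_lt ?_
  have hm1 : Measurable fun Z : Fin n → EuclideanSpace K (Fin d) =>
      ENNReal.ofReal (RCLike.re (h.1 * gram Z * (h.1)ᴴ).trace) := by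
    have : Continuous fun X : Matrix (Fin d) (Fin d) K => RCLike.re (h.1 * X * (h.1)ᴴ).trace :=
      RCLike.continuous_re.comp (by fun_prop)
    exact (this.measurable.comp measurable_gram).ennreal_ofReal
  have hm2 : Measurable fun Z : Fin n → EuclideanSpace K (Fin d) =>
      2 + ENNReal.ofReal (RCLike.re (h.1 * gram Z * (h.1)ᴴ).trace) := measurable_const.add hm1
  rw [lintegral_const_mul' _ _ ENNReal.ofReal_ne_top, lintegral_add_left hm2,
    lintegral_add_left measurable_const,
    lintegral_const_mul']
  · refine ENNReal.mul_lt_top ENNReal.ofReal_lt_top (ENNReal.add_lt_top.2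
      ⟨ENNReal.add_lt_top.2 ⟨by simp, (lintegral_re_trace_conj_gram_ne_top h.1).lt_top⟩, ?_⟩)
    refine ENNReal.mul_lt_top ?_ (lintegral_det_gram_rpow_ne_top hn).lt_top
    refine (ENNReal.rpow_ne_top_of_ne_zero ?_ enorm_ne_top).lt_top
    simp [hdet]
  · exact ENNReal.rpow_ne_top_of_ne_zero (by simp [hdet]) enorm_ne_top

end Finiteness

/-! ### Strict minimality at the identity -/

section Minimizer

variable {K : Type*} [RCLike K] {d n : ℕ}

lemma cfc_unitary_conj {X g : Matrix (Fin d) (Fin d) K} (hX : X.PosDef) (hg : gᴴ * g = 1)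
    (f : ℝ → ℝ) : cfc f (g * X * gᴴ) = g * cfc f X * gᴴ := by
  set u : unitary (Matrix (Fin d) (Fin d) K) :=
    ⟨g, Unitary.mem_iff.2 ⟨hg, mul_eq_one_comm.1 hg⟩⟩
  have hc : Continuous (Unitary.conjStarAlgAut K (Matrix (Fin d) (Fin d) K) u) := by
    have : (Unitary.conjStarAlgAut K (Matrix (Fin d) (Fin d) K) u : _ → _)
        = fun Y => g * Y * gᴴ := by
      ext1 Y; rfl
    rw [this]
    fun_prop
  -- On a finite spectrum every function is continuous, so `f` needs no regularity.
  have hs : (spectrum ℝ X).Finite := finite_real_spectrum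
  exact (StarAlgHomClass.map_cfc (Unitary.conjStarAlgAut K (Matrix (Fin d) (Fin d) K) u) f X
    (hs.continuousOn f) hc hX.1 (hX.1.isSelfAdjoint.map _)).symm

lemma coe_act_of_unitary (g : GL (Fin d) K) (hg : (g.1)ᴴ * g.1 = 1) (y : UnitDet K d) :
    (act g y).1 = g.1 * y.1 * (g.1)ᴴ := by
  have hdet : (g.1 * y.1 * (g.1)ᴴ).det = 1 := by
    rw [det_mul, det_mul, y.2.2, mul_one, mul_comm, ← det_mul, hg, det_one]
  have hp := y.2.1.mul_mul_conjTranspose_of_isUnit g.isUnit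
  obtain ⟨r, hr, e⟩ := exists_coe_act g y
  exact congrArg Subtype.val (unitDet_eq_of_smul (x := act g y) (y := ⟨_, hp, hdet⟩) hr one_pos e
    (one_smul _ _).symm)

lemma log_act_of_unitary (g : GL (Fin d) K) (hg : (g.1)ᴴ * g.1 = 1) (y : UnitDet K d) :
    cfc Real.log (act g y).1 = g.1 * cfc Real.log y.1 * (g.1)ᴴ := by
  rw [coe_act_of_unitary g hg, cfc_unitary_conj y.2.1 hg]

/-- A matrix `g` with `g^* g = 1`, as an invertible matrix. -/
def unitaryGL (g : Matrix (Fin d) (Fin d) K) (hg : gᴴ * g = 1) : GL (Fin d) K :=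
  ⟨g, gᴴ, mul_eq_one_comm.1 hg, hg⟩

lemma integrable_frobeniusNorm_log_sq (hd : 1 ≤ d) (hn : d ≤ n) :
    Integrable (fun y => frobeniusNorm (cfc Real.log y.1) ^ 2) (stdLaw K d n) := by
  have h := frechetFunction_stdLaw_lt_top (K := K) hd hn 1 1
  rw [frechetFunction] at h
  simp only [affDist_one_left, one_mul] at h
  refine ⟨((measurable_frobeniusNorm.comp measurable_log_unitDet).pow_const 2).aestronglyMeasurable,
    ?_⟩
  rw [hasFiniteIntegral_iff_ofReal (Filter.Eventually.of_forall fun y => sq_nonneg _)]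
  exact h

lemma integrable_re_log_apply (hd : 1 ≤ d) (hn : d ≤ n) (i j : Fin d) :
    Integrable (fun y : UnitDet K d => RCLike.re (cfc Real.log y.1 i j)) (stdLaw K d n) := by
  refine ((integrable_const (1 : ℝ)).add (integrable_frobeniusNorm_log_sq hd hn)).mono'
    (RCLike.measurable_re.comp
      (measurable_matrix_iff.1 measurable_log_unitDet i j)).aestronglyMeasurable
    (Filter.Eventually.of_forall fun y => ?_)
  have h1 : ‖cfc Real.log y.1 i j‖ ^ 2 ≤ frobeniusNorm (cfc Real.log y.1) ^ 2 := by
    rw [frobeniusNorm_sq]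
    exact (Finset.single_le_sum (f := fun j => ‖cfc Real.log y.1 i j‖ ^ 2)
      (fun j _ => sq_nonneg _) (Finset.mem_univ j)).trans
      (Finset.single_le_sum (f := fun i => ∑ j, ‖cfc Real.log y.1 i j‖ ^ 2)
        (fun i _ => Finset.sum_nonneg fun j _ => sq_nonneg _) (Finset.mem_univ i))
  have h2 : ‖RCLike.re (cfc Real.log y.1 i j)‖ ≤ ‖cfc Real.log y.1 i j‖ := RCLike.norm_re_le_norm _
  simp only [Pi.add_apply]
  nlinarith [sq_nonneg (‖cfc Real.log y.1 i j‖ - 1), norm_nonneg (cfc Real.log y.1 i j)]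

lemma integrable_re_conj_log_apply (hd : 1 ≤ d) (hn : d ≤ n) {g : Matrix (Fin d) (Fin d) K}
    (hg : gᴴ * g = 1) (i j : Fin d) :
    Integrable (fun y : UnitDet K d =>
        RCLike.re ((g * cfc Real.log y.1 * gᴴ : Matrix (Fin d) (Fin d) K) i j))
      (stdLaw K d n) := by
  have h := integrable_re_log_apply (K := K) hd hn i j
  rw [← stdLaw_map_act hn (unitaryGL g hg) hg] at h
  refine (h.comp_measurable (measurable_act _)).congr (Filter.Eventually.of_forall fun y => ?_)
  exact congrArg (fun M : Matrix (Fin d) (Fin d) K => RCLike.re (M i j))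
    (log_act_of_unitary (unitaryGL g hg) hg y)

lemma integral_re_conj_log_apply (hn : d ≤ n) {g : Matrix (Fin d) (Fin d) K} (hg : gᴴ * g = 1)
    (i j : Fin d) :
    ∫ y, RCLike.re ((g * cfc Real.log y.1 * gᴴ : Matrix (Fin d) (Fin d) K) i j) ∂stdLaw K d n
      = ∫ y, RCLike.re (cfc Real.log y.1 i j) ∂stdLaw K d n := by
  conv_rhs => rw [← stdLaw_map_act hn (unitaryGL g hg) hg]
  have hm : Measurable fun y : UnitDet K d => RCLike.re (cfc Real.log y.1 i j) :=
    RCLike.measurable_re.comp (measurable_matrix_iff.1 measurable_log_unitDet i j)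
  rw [integral_map (measurable_act _).aemeasurable hm.aestronglyMeasurable]
  refine integral_congr_ae (Filter.Eventually.of_forall fun y => ?_)
  exact congrArg (fun M : Matrix (Fin d) (Fin d) K => RCLike.re (M i j))
    (log_act_of_unitary (unitaryGL g hg) hg y).symm

/-- The matrix of the transposition of `i` and `j` is unitary, and conjugating by it exchanges the
two diagonal entries. -/
lemma integral_re_log_diag_eq (hn : d ≤ n) (i j : Fin d) :
    ∫ y, RCLike.re (cfc Real.log y.1 i i) ∂stdLaw K d n
      = ∫ y, RCLike.re (cfc Real.log y.1 j j) ∂stdLaw K d n := by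
  set g : Matrix (Fin d) (Fin d) K := (1 : Matrix (Fin d) (Fin d) K).submatrix (Equiv.swap i j) id
  have hgc : gᴴ = (1 : Matrix (Fin d) (Fin d) K).submatrix id (Equiv.swap i j) := by
    rw [conjTranspose_submatrix, conjTranspose_one]
  have hconj : ∀ M : Matrix (Fin d) (Fin d) K,
      g * M * gᴴ = M.submatrix (Equiv.swap i j) (Equiv.swap i j) := by
    intro M
    ext a b
    rw [hgc]
    simp [g, Matrix.mul_apply, Matrix.one_apply]
  have hg : gᴴ * g = 1 := by
    refine mul_eq_one_comm.1 ?_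
    have := hconj 1
    rw [Matrix.mul_one] at this
    rw [this, submatrix_one_equiv]
  rw [← integral_re_conj_log_apply hn hg i i]
  simp only [hconj, submatrix_apply, Equiv.swap_apply_left]

/-- In an eigenbasis of `x` only the diagonal entries of log y contribute. Unitary invariance gives
them a common mean, which multiplies tr log x = log det x = 0. -/
lemma integral_re_trace_log_mul_log (hd : 1 ≤ d) (hn : d ≤ n) (x : UnitDet K d) :
    Integrable (fun y : UnitDet K d => RCLike.re (cfc Real.log x.1 * cfc Real.log y.1).trace)
      (stdLaw K d n) ∧
    ∫ y, RCLike.re (cfc Real.log x.1 * cfc Real.log y.1).trace ∂stdLaw K d n = 0 := by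
  obtain ⟨V, z, hV, hV', hz, hx, hf⟩ := exists_spectral x.2.1
  have hlog : ∑ i, Real.log (z i) = 0 := by
    have h := x.2.2
    rw [hx, det_mul_comm, ← Matrix.mul_assoc, hV, Matrix.one_mul, realDiag, det_diagonal] at h
    rw [← Real.log_prod fun i _ => (hz i).ne', show ∏ i, z i = 1 by exact_mod_cast h,
      Real.log_one]
  have hVc : (Vᴴ)ᴴ * Vᴴ = 1 := by rwa [conjTranspose_conjTranspose]
  have key : ∀ y : UnitDet K d, RCLike.re (cfc Real.log x.1 * cfc Real.log y.1).trace
      = ∑ i, Real.log (z i) *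
          RCLike.re ((Vᴴ * cfc Real.log y.1 * (Vᴴ)ᴴ : Matrix (Fin d) (Fin d) K) i i) := by
    intro y
    rw [hf, Matrix.mul_assoc, Matrix.mul_assoc, trace_mul_comm, conjTranspose_conjTranspose,
      Matrix.mul_assoc, Matrix.mul_assoc]
    simp only [trace, diag_apply, realDiag, diagonal_mul, map_sum, RCLike.re_ofReal_mul]
  simp only [key]
  have hint := fun i => (integrable_re_conj_log_apply (K := K) hd hn hVc i i).const_mul
    (Real.log (z i))
  refine ⟨integrable_finsetSum _ fun i _ => hint i, ?_⟩
  rw [integral_finsetSum _ fun i _ => hint i]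
  simp only [integral_const_mul, integral_re_conj_log_apply hn hVc,
    fun i => integral_re_log_diag_eq (K := K) hn i ⟨0, hd⟩]
  rw [← Finset.sum_mul, hlog, zero_mul]

lemma frobeniusNorm_log_sub_log_sq (x y : UnitDet K d) :
    frobeniusNorm (cfc Real.log x.1 - cfc Real.log y.1) ^ 2
      = frobeniusNorm (cfc Real.log x.1) ^ 2 + frobeniusNorm (cfc Real.log y.1) ^ 2
        - 2 * RCLike.re (cfc Real.log x.1 * cfc Real.log y.1).trace := by
  have h : ∀ y : UnitDet K d, (cfc Real.log y.1)ᴴ = cfc Real.log y.1 := fun y =>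
    (cfc_predicate (R := ℝ) (p := IsSelfAdjoint) Real.log y.1)
  simp only [frobeniusNorm_sq_eq_trace, conjTranspose_sub, h]
  rw [Matrix.sub_mul, Matrix.mul_sub, Matrix.mul_sub]
  simp only [trace_sub, map_sub]
  rw [trace_mul_comm (cfc Real.log y.1) (cfc Real.log x.1)]
  ring

lemma log_unitDet_ne_zero {x : UnitDet K d} (hx : x ≠ 1) :
    0 < frobeniusNorm (cfc Real.log x.1) := by
  refine lt_of_le_of_ne (frobeniusNorm_nonneg _) fun h => hx ?_
  have h0 := frobeniusNorm_eq_zero h.symm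
  obtain ⟨V, z, hV, hV', hz, hxV, hf⟩ := exists_spectral x.2.1
  have h1 : ∑ i, Real.log (z i) ^ 2 = 0 := by
    rw [← frobeniusNorm_conj_realDiag_sq hV, ← hf, ← h]; ring
  have h2 : ∀ i, z i = 1 := fun i => by
    have h3 := (Finset.sum_eq_zero_iff_of_nonneg fun i _ => sq_nonneg (Real.log (z i))).1 h1 i
      (Finset.mem_univ i)
    exact Real.eq_one_of_pos_of_log_eq_zero (hz i) (pow_eq_zero_iff two_ne_zero |>.1 h3)
  refine Subtype.ext ?_
  rw [hxV, coe_one_unitDet, show z = fun _ => 1 from funext h2, realDiag_one, Matrix.mul_one, hV']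

/-- The gap is at least c²‖log x‖²: the logarithm contracts distances, distances from 1 are
preserved exactly, and the cross term integrates to zero. -/
lemma frechetFunction_stdLaw_one_lt (hd : 1 ≤ d) (hn : d ≤ n) {c : ℝ} (hc : 0 < c)
    {x : UnitDet K d} (hx : x ≠ 1) :
    frechetFunction (affDist c) (stdLaw K d n) 1
      < frechetFunction (affDist c) (stdLaw K d n) x := by
  have hint : ∀ x, Integrable (fun y => affDist c x y ^ 2) (stdLaw K d n) := fun x => by
    refine ⟨((measurable_affDist c x).pow_const 2).aestronglyMeasurable, ?_⟩
    rw [hasFiniteIntegral_iff_ofReal (Filter.Eventually.of_forall fun y => sq_nonneg _)]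
    exact frechetFunction_stdLaw_lt_top hd hn c x
  -- Finiteness permits the passage to real integrals, where the cross term can be subtracted.
  have hF : ∀ x, frechetFunction (affDist c) (stdLaw K d n) x
      = ENNReal.ofReal (∫ y, affDist c x y ^ 2 ∂stdLaw K d n) := fun x =>
    (ofReal_integral_eq_lintegral_ofReal (hint x)
      (Filter.Eventually.of_forall fun y => sq_nonneg _)).symm
  obtain ⟨hi, h0⟩ := integral_re_trace_log_mul_log (K := K) hd hn x
  have hL := integrable_frobeniusNorm_log_sq (K := K) hd hn
  have hL' : Integrable (fun y => frobeniusNorm (cfc Real.log x.1) ^ 2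
      + frobeniusNorm (cfc Real.log y.1) ^ 2) (stdLaw K d n) := (integrable_const _).add hL
  set A := frobeniusNorm (cfc Real.log x.1) with hA
  have h1 : ∫ y, affDist c 1 y ^ 2 ∂stdLaw K d n
      = c ^ 2 * ∫ y, frobeniusNorm (cfc Real.log y.1) ^ 2 ∂stdLaw K d n := by
    simp only [affDist_one_left, mul_pow, integral_const_mul]
  have h2 : ∫ y, c ^ 2 * frobeniusNorm (cfc Real.log x.1 - cfc Real.log y.1) ^ 2 ∂stdLaw K d n
      = c ^ 2 * A ^ 2 + ∫ y, affDist c 1 y ^ 2 ∂stdLaw K d n := by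
    simp only [frobeniusNorm_log_sub_log_sq]
    rw [h1, integral_const_mul, integral_sub hL' (hi.const_mul 2),
      integral_add (integrable_const _) hL, integral_const_mul, h0, integral_const]
    simp
    ring
  have h3 : ∫ y, c ^ 2 * frobeniusNorm (cfc Real.log x.1 - cfc Real.log y.1) ^ 2 ∂stdLaw K d n
      ≤ ∫ y, affDist c x y ^ 2 ∂stdLaw K d n := by
    refine integral_mono ?_ (hint x) fun y => ?_
    · simp only [frobeniusNorm_log_sub_log_sq]
      exact (hL'.sub (hi.const_mul 2)).const_mul _
    · simp only [← mul_pow]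
      exact pow_le_pow_left₀ (mul_nonneg hc.le (frobeniusNorm_nonneg _))
        (frobeniusNorm_log_sub_log_le_affDist hc.le x y) 2
  have hApos : 0 < c ^ 2 * A ^ 2 := mul_pos (pow_pos hc 2) (pow_pos (log_unitDet_ne_zero hx) 2)
  have h4 : 0 ≤ ∫ y, affDist c 1 y ^ 2 ∂stdLaw K d n := integral_nonneg fun y => sq_nonneg _
  rw [hF, hF]
  exact (ENNReal.ofReal_lt_ofReal_iff (by linarith)).2 (by linarith)

lemma frechetFunction_projWishart (hn : d ≤ n) (C : PosDefMat K d) (c : ℝ) (x : UnitDet K d) :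
    frechetFunction (affDist c) (projWishart C n) x
      = frechetFunction (affDist c) (stdLaw K d n) (act (sqrtGL C)⁻¹ x) := by
  rw [frechetFunction, projWishart_eq_map hn,
    lintegral_map ((measurable_affDist c _).pow_const 2).ennreal_ofReal (measurable_act _),
    frechetFunction]
  refine lintegral_congr fun y => ?_
  rw [affDist_act_left_sq, inv_inv]

end Minimizer

end ProjWishart

end

/-- For `d ≤ n`, the Fréchet function of the projective Wishart distribution is finite everywhere,
and its minimum is attained at `π(C)` and only there. -/
theorem theorem1 {K : Type*} [RCLike K] (d n : ℕ) (hd : 1 ≤ d) (hn : d ≤ n)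
    (C : ProjWishart.PosDefMat K d) (c : ℝ) (hc : 0 < c) :
    (∀ x : ProjWishart.UnitDet K d,
      ProjWishart.frechetFunction (ProjWishart.affDist c) (ProjWishart.projWishart C n) x < ∞) ∧
    ProjWishart.frechetMeans (ProjWishart.affDist c) (ProjWishart.projWishart C n)
      = {ProjWishart.proj C} := by
  -- The isometry that whitens the covariance sends exactly one point to the minimizer 1 of the
  -- standard problem.
  have key : ∀ x, ProjWishart.act (ProjWishart.sqrtGL C)⁻¹ x = 1 ↔ x = ProjWishart.proj C := by
    intro x
    rw [← ProjWishart.act_sqrtGL_one]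
    constructor
    · intro h
      rw [← h, ← ProjWishart.act_mul, mul_inv_cancel, ProjWishart.act_one]
    · rintro rfl
      rw [← ProjWishart.act_mul, inv_mul_cancel, ProjWishart.act_one]
  refine ⟨fun x => ?_, ?_⟩
  · rw [ProjWishart.frechetFunction_projWishart hn]
    exact ProjWishart.frechetFunction_stdLaw_lt_top hd hn c _
  · ext x
    simp only [ProjWishart.frechetMeans, Set.mem_ofPred_eq, Set.mem_singleton_iff,
      ProjWishart.frechetFunction_projWishart hn]
    rw [← key]
    constructor
    · intro h
      by_contra hx
      have h1 := h (ProjWishart.proj C)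
      rw [(key _).2 rfl] at h1
      exact absurd (ProjWishart.frechetFunction_stdLaw_one_lt hd hn hc hx) h1.not_gt
    · intro hx z
      rw [hx]
      by_cases hz : ProjWishart.act (ProjWishart.sqrtGL C)⁻¹ z = 1
      · rw [hz]
      · exact (ProjWishart.frechetFunction_stdLaw_one_lt hd hn hc hz).le
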